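/- For $\tau$ in the upper half-plane let $\wp=\wp(\,\cdot\,|2,2\tau)$ be the Weierstrass function with half-periods $2,2\tau$ (period lattice $4\mathbb Z+4\tau\mathbb Z$), and let Burnside's functions be $$x(\tau)=\frac{\wp(1)-\wp(2)}{\wp(\tau)-\wp(2)},$$ $$y(\tau)=4i\,\frac{[\wp(\tau)-\wp(2\tau)]\,[\wp(\frac\tau2)-\wp(\tau)]\,[\wp(\frac\tau2)-\wp(\tau+2)]\,[\wp(\frac12)-\wp(2\tau+1)]\,[\wp(\frac12)-\wp(1)]}{[\wp(\frac\tau2)-\wp(1)]\,[\wp(\frac\tau2)-\wp(2\tau+1)]\,\wp'(\frac12)\,\wp'(\tau)} .$$ To the four branch points $e\in\{1,-1,i,-i\}$ of the curve $y^2=x^5-x$, which correspond to the cusps $\tau=\frac12,\ i\infty,\ 1,\ -1$ respectively, attach the local coordinates $$q_{1}=e^{\frac{\pi i}{4}\frac{3\tau-2}{2\tau-1}},\qquad q_{-1}=e^{\frac{\pi i}{4}(\tau-2)},\qquad q_{i}=e^{\frac{\pi i}{4}\frac{\tau-2}{\tau-1}},\qquad q_{-i}=e^{\frac{\pi i}{4}\frac{3\tau+2}{\tau+1}}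 .$$ **Proposition 6.** There are integer sequences $(a_n)_{n\ge0}=(1,4,8,16,32,56,96,\dots)$ and $(b_n)_{n\ge0}=(1,6,24,80,231,606,\dots)$ such that the following holds. 1. For every complex $q$ with $|q|<1$ the two products below converge, the two series below converge, and $$\sum_{n\ge0}a_nq^{2n}=\prod_{k=1}^\infty(1+q^{4k})^2(1+q^{4k-2})^4,\qquad \sum_{n\ge0}b_nq^{2n}=\prod_{k=1}^\infty(1+q^{4k})^3(1+q^{2k})^6 .$$ 2. These are the canonical developments of Burnside's functions at the four branch points: for each $e\in\{1,-1,i,-i\}$ there is a constant $s$ with $s^2=e$ such that for all $\tau$ in the upper half-plane, with $q=q_e(\tau)$, one has $|q|<1$ and $$x(\tau)=e\sum_{n\ge0}a_nq^{2n}=e\prod_{k=1}^\infty(1+q^{4k})^2(1+q^{4k-2})^4,$$ $$y(\tau)=4s\,q\sum_{n\ge0}b_nq^{2n}=4s\,q\prod_{k=1}^\infty(1+q^{4k})^3(1+q^{2k})^6 .$$ 3. For each $e\in\{1,-1,i,-i\}$, each $s$ with $s^2=e$ and each complex $q$ with $|q|<1$, the products $$X=e\prod_{k=1}^\infty(1+q^{4k})^2(1+q^{4k-2})^4,\qquad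 Y=4s\,q\prod_{k=1}^\infty(1+q^{4k})^3(1+q^{2k})^6$$ satisfy $Y^2=X^5-X$. -/

import Mathlib

noncomputable section

/-- The pair of periods `(4, 4τ)`, that is, half-periods `(2, 2τ)`. -/
def burnsidePeriods (τ : UpperHalfPlane) : PeriodPair where
  ω₁ := 4
  ω₂ := 4 * (τ : ℂ)
  indep := by
    rw [LinearIndependent.pair_iff]
    intro s t h
    have him := congrArg Complex.im h
    have hre := congrArg Complex.re h
    have hτ := τ.im_pos.ne'
    simp at him hre
    rcases him with h0 | h0
    · subst h0
      simpa using hre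
    · exact absurd h0 hτ

/-- Burnside's function
`x(τ) = (℘(1) - ℘(2)) / (℘(τ) - ℘(2))`, with `℘ = ℘(· | 2, 2τ)`. -/
def burnsideX (τ : UpperHalfPlane) : ℂ :=
  let P := (burnsidePeriods τ).weierstrassP
  (P 1 - P 2) / (P τ - P 2)

/-- Burnside's function `y(τ)`, with `℘ = ℘(· | 2, 2τ)`. -/
def burnsideY (τ : UpperHalfPlane) : ℂ :=
  let P := (burnsidePeriods τ).weierstrassP
  let P' := (burnsidePeriods τ).derivWeierstrassP
  4 * Complex.I *
    ((P τ - P (2 * τ)) * (P (τ / 2) - P τ) * (P (τ / 2) - P (τ + 2)) *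
      (P (1 / 2) - P (2 * τ + 1)) * (P (1 / 2) - P 1)) /
    ((P (τ / 2) - P 1) * (P (τ / 2) - P (2 * τ + 1)) * P' (1 / 2) * P' τ)

/-- The four cusps `τ = 1/2, i∞, 1, -1` above the branch points `±1, ±i`. -/
inductive BurnsideCusp : Type
  | half
  | infty
  | one
  | negOne

/-- The branch point `e`, the value of Burnside's `x` at the cusp. -/
def BurnsideCusp.branchValue : BurnsideCusp → ℂ
  | .half => 1
  | .infty => -1
  | .one => Complex.I
  | .negOne => -Complex.I

/-- The unimodular Möbius image of `τ` that defines the local coordinate at the cusp. -/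
def BurnsideCusp.moebius : BurnsideCusp → ℂ → ℂ
  | .half, τ => (3 * τ - 2) / (2 * τ - 1)
  | .infty, τ => τ - 2
  | .one, τ => (τ - 2) / (τ - 1)
  | .negOne, τ => (3 * τ + 2) / (τ + 1)

/-- The local coordinate `q` at the cusp, as a function of `τ`. -/
def BurnsideCusp.q (c : BurnsideCusp) (τ : UpperHalfPlane) : ℂ :=
  Complex.exp (Real.pi * Complex.I / 4 * c.moebius τ)

/-- The factor of index `k + 1` of `∏_{k ≥ 1} (1 + q^{4k})² (1 + q^{4k-2})⁴`. -/
def burnsideFactorX (q : ℂ) (k : ℕ) : ℂ :=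
  (1 + q ^ (4 * (k + 1))) ^ 2 * (1 + q ^ (4 * k + 2)) ^ 4

/-- The factor of index `k + 1` of `∏_{k ≥ 1} (1 + q^{4k})³ (1 + q^{2k})⁶`. -/
def burnsideFactorY (q : ℂ) (k : ℕ) : ℂ :=
  (1 + q ^ (4 * (k + 1))) ^ 3 * (1 + q ^ (2 * (k + 1))) ^ 6

end

/-! Everything is expressed through φ(p) = ∏ (1 - p^m), m odd (`oddProduct`). Euler's identity ∏ (1
+ pⁿ) = 1/φ(p) and φ(p)φ(-p) = φ(p²) turn the two products into φ(q⁴)²/φ(q²)⁴ and 1/(φ(q²)⁶φ(q⁴)³).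
The curve equation then becomes Jacobi's identity `oddProduct_neg_pow_eight` at p = q².

The analytic input is the theta quotient formula for ℘(u) - ℘(v) (`weierstrassP_sub`), which follows
from Liouville's theorem, together with its limit for ℘'. Jacobi's identity is the additive relation
between the three differences of the half-period values of ℘.

For x, an element of SL₂(ℤ) moves each cusp to i∞. It preserves the period lattice up to a scalar,
and the weight of ℘ cancels in the quotient defining x. Quasi-periodicity of theta reduces every
case to the same quotient, and its multipliers produce the branch value e.

For y, only the cusp i∞ is computed. This gives y² = x⁵ - x on the upper half-plane. At any other
cusp the proposed product has the same square and no zeros, so by connectedness it equals y up to a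
constant sign, which is absorbed into s (`exists_burnsideY_eq`).

The integer coefficients are the stable coefficients of the partial products. Their nonnegativity
gives absolute convergence (`hasSum_prodCoeff_blocks`). -/

/-! ### q-Pochhammer symbols -/

/-- The `q`-Pochhammer symbol `(z; Q)_∞ = ∏_{n ≥ 0} (1 - Qⁿ z)`. -/
noncomputable def qPochhammer (Q z : ℂ) : ℂ := ∏' n : ℕ, (1 - Q ^ n * z)

theorem summable_norm_pow_mul {Q : ℂ} (hQ : ‖Q‖ < 1) (z : ℂ) :
    Summable fun n : ℕ => ‖-(Q ^ n * z)‖ := by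
  simpa using (summable_geometric_of_lt_one (norm_nonneg _) hQ).mul_right ‖z‖

theorem multipliable_one_sub_pow_mul {Q : ℂ} (hQ : ‖Q‖ < 1) (z : ℂ) :
    Multipliable fun n : ℕ => 1 - Q ^ n * z := by
  simpa [sub_eq_add_neg] using multipliable_one_add_of_summable (summable_norm_pow_mul hQ z)

theorem hasProd_qPochhammer {Q : ℂ} (hQ : ‖Q‖ < 1) (z : ℂ) :
    HasProd (fun n : ℕ => 1 - Q ^ n * z) (qPochhammer Q z) :=
  (multipliable_one_sub_pow_mul hQ z).hasProd

theorem qPochhammer_ne_zero {Q z : ℂ} (hQ : ‖Q‖ < 1) (h : ∀ n : ℕ, 1 - Q ^ n * z ≠ 0) :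
    qPochhammer Q z ≠ 0 := by
  have := tprod_one_add_ne_zero_of_summable (f := fun n : ℕ => -(Q ^ n * z))
    (by simpa [sub_eq_add_neg] using h) (summable_norm_pow_mul hQ z)
  simpa [qPochhammer, sub_eq_add_neg] using this

theorem qPochhammer_ne_zero_of_norm_lt {Q z : ℂ} (hQ : ‖Q‖ < 1) (hz : ‖z‖ < 1) :
    qPochhammer Q z ≠ 0 := by
  refine qPochhammer_ne_zero hQ fun n h => ?_
  have h1 : ‖Q ^ n * z‖ < 1 := by
    rw [norm_mul, norm_pow]
    exact (mul_le_of_le_one_left (norm_nonneg _)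
      (pow_le_one₀ (norm_nonneg _) hQ.le)).trans_lt hz
  rw [← sub_eq_zero.mp h] at h1
  simp at h1

theorem norm_sq_lt_one {Q : ℂ} (hQ : ‖Q‖ < 1) : ‖Q ^ 2‖ < 1 := by
  rw [norm_pow]
  exact pow_lt_one₀ (norm_nonneg _) hQ two_ne_zero

theorem qPochhammer_eq {Q : ℂ} (hQ : ‖Q‖ < 1) (z : ℂ) :
    qPochhammer Q z = (1 - z) * qPochhammer Q (Q * z) := by
  have h : HasProd (fun n : ℕ => 1 - Q ^ (n + 1) * z) (qPochhammer Q (Q * z)) := by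
    simpa only [pow_succ, mul_assoc] using hasProd_qPochhammer hQ (Q * z)
  have h' := HasProd.zero_mul (f := fun n : ℕ => 1 - Q ^ n * z) h
  simpa using (hasProd_qPochhammer hQ z).unique h'

theorem qPochhammer_mul_neg {Q : ℂ} (hQ : ‖Q‖ < 1) (z : ℂ) :
    qPochhammer Q z * qPochhammer Q (-z) = qPochhammer (Q ^ 2) (z ^ 2) := by
  have h := (hasProd_qPochhammer hQ z).mul (hasProd_qPochhammer hQ (-z))
  have h' := hasProd_qPochhammer (norm_sq_lt_one hQ) (z ^ 2)
  have e : (fun n : ℕ => (1 - Q ^ n * z) * (1 - Q ^ n * -z)) =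
      fun n : ℕ => 1 - (Q ^ 2) ^ n * z ^ 2 := by
    funext n
    ring
  rw [e] at h
  exact h.unique h'

theorem qPochhammer_even_mul_odd {Q : ℂ} (hQ : ‖Q‖ < 1) (z : ℂ) :
    qPochhammer (Q ^ 2) z * qPochhammer (Q ^ 2) (Q * z) = qPochhammer Q z := by
  have h1 := hasProd_qPochhammer (norm_sq_lt_one hQ) z
  have h2 := hasProd_qPochhammer (norm_sq_lt_one hQ) (Q * z)
  simp only [← mul_assoc, ← pow_mul, ← pow_succ] at h1 h2
  exact (HasProd.even_mul_odd (f := fun n : ℕ => 1 - Q ^ n * z) h1 h2).unique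
    (hasProd_qPochhammer hQ z)

theorem differentiable_qPochhammer {Q : ℂ} (hQ : ‖Q‖ < 1) : Differentiable ℂ (qPochhammer Q) := by
  intro z
  have hb : IsOpen (Metric.ball (0 : ℂ) (‖z‖ + 1)) := Metric.isOpen_ball
  have h := Summable.hasProdLocallyUniformlyOn_nat_one_add (f := fun (n : ℕ) (w : ℂ) =>
    -(Q ^ n * w)) hb
    (u := fun n => ‖Q‖ ^ n * (‖z‖ + 1))
    ((summable_geometric_of_lt_one (norm_nonneg _) hQ).mul_right _)
    (.of_forall fun n w hw => by
      rw [norm_neg, norm_mul, norm_pow]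
      have : ‖w‖ ≤ ‖z‖ + 1 := by simpa using (mem_ball_zero_iff.mp hw).le
      gcongr) (fun n => by fun_prop)
  have h' := h.differentiableOn
    (.of_forall fun _ => by simpa [Finset.prod_fn] using
      DifferentiableOn.finsetProd (fun _ _ => by fun_prop)) hb
  have := h'.differentiableAt (hb.mem_nhds (x := z) (by simp))
  simpa only [← sub_eq_add_neg] using! this

@[fun_prop]
theorem differentiable_qPochhammer_comp {Q : ℂ} (hQ : ‖Q‖ < 1) {f : ℂ → ℂ}
    (hf : Differentiable ℂ f) :
    Differentiable ℂ fun z => qPochhammer Q (f z) :=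
  (differentiable_qPochhammer hQ).comp hf

/-! ### Products over odd exponents and closed forms of the two products -/

/-- The product `∏ (1 - p^m)` over the odd `m`. -/
noncomputable def oddProduct (p : ℂ) : ℂ := qPochhammer (p ^ 2) p

theorem oddProduct_ne_zero {p : ℂ} (hp : ‖p‖ < 1) : oddProduct p ≠ 0 :=
  qPochhammer_ne_zero_of_norm_lt (norm_sq_lt_one hp) hp

/-- Both factors have base p² = (-p)², so the terms pair off as (1 - p^m)(1 + p^m). -/
theorem oddProduct_mul_neg {p : ℂ} (hp : ‖p‖ < 1) :
    oddProduct p * oddProduct (-p) = oddProduct (p ^ 2) := by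
  have := qPochhammer_mul_neg (norm_sq_lt_one hp) p
  simpa [oddProduct] using this

theorem oddProduct_mul_qPochhammer {p : ℂ} (hp : ‖p‖ < 1) :
    oddProduct p * qPochhammer (p ^ 2) (p ^ 2) = qPochhammer p p := by
  have := qPochhammer_even_mul_odd hp p
  rwa [← pow_two] at this

/-- Euler's identity `∏ (1 + pⁿ) ∏ (1 - p^{2n-1}) = 1`. -/
theorem oddProduct_mul_qPochhammer_neg {p : ℂ} (hp : ‖p‖ < 1) :
    oddProduct p * qPochhammer p (-p) = 1 := by
  have h1 := qPochhammer_mul_neg hp p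
  have h2 := oddProduct_mul_qPochhammer hp
  have h3 := qPochhammer_ne_zero_of_norm_lt hp hp
  apply mul_left_cancel₀ h3
  linear_combination oddProduct p * h1 + h2

/-- Here the base varies too. With P(p) = ∏ (1 - pⁿ), known to be holomorphic on the disc, φ(p) =
P(p)/P(p²). -/
theorem continuousOn_oddProduct : ContinuousOn oddProduct (Metric.ball 0 1) := by
  have hd := ModularForm.differentiableOn_tprod_one_sub_pow.continuousOn
  have e : ∀ p : ℂ, ∏' n : ℕ, (1 - p ^ (n + 1)) = qPochhammer p p := fun p => by
    simp only [qPochhammer, pow_succ]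
  simp only [e] at hd
  have h2 : ContinuousOn (fun p : ℂ => qPochhammer (p ^ 2) (p ^ 2)) (Metric.ball 0 1) :=
    hd.comp (f := fun p : ℂ => p ^ 2) (by fun_prop) fun p hp => by
      rw [mem_ball_zero_iff] at hp ⊢
      exact norm_sq_lt_one hp
  refine (hd.div h2 fun p hp => ?_).congr fun p hp => ?_ <;> rw [mem_ball_zero_iff] at hp <;>
    have h := qPochhammer_ne_zero_of_norm_lt (norm_sq_lt_one hp) (norm_sq_lt_one hp)
  · exact h
  · exact (eq_div_iff h).mpr (oddProduct_mul_qPochhammer hp)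

/-- ∏ (1 + q^{4k}) = 1/φ(q⁴) by Euler, and ∏ (1 + q^{4k-2}) = φ(-q²) = φ(q⁴)/φ(q²). -/
theorem hasProd_burnsideFactorX {q : ℂ} (hq : ‖q‖ < 1) :
    HasProd (burnsideFactorX q) (oddProduct (q ^ 4) ^ 2 / oddProduct (q ^ 2) ^ 4) := by
  have hq2 := norm_sq_lt_one hq
  have hq4 := norm_sq_lt_one hq2
  have h := ((hasProd_qPochhammer hq4 (-(q ^ 2) ^ 2)).pow 2).mul
    ((hasProd_qPochhammer hq4 (-q ^ 2)).pow 4)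
  have e1 := oddProduct_mul_qPochhammer_neg hq4
  have e2 := oddProduct_mul_neg hq2
  have n1 := oddProduct_ne_zero hq2
  have n2 := oddProduct_ne_zero hq4
  convert h using 1
  · funext k
    simp only [burnsideFactorX]
    ring
  · have e3 : qPochhammer ((q ^ 2) ^ 2) (-q ^ 2) = oddProduct (-q ^ 2) := by simp [oddProduct]
    rw [e3, eq_div_of_mul_eq n1 ((mul_comm _ _).trans e2),
      eq_div_of_mul_eq n2 ((mul_comm _ _).trans e1), ← pow_mul]
    rw [← pow_mul] at n2
    field_simp

theorem hasProd_burnsideFactorY {q : ℂ} (hq : ‖q‖ < 1) :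
    HasProd (burnsideFactorY q) (1 / (oddProduct (q ^ 2) ^ 6 * oddProduct (q ^ 4) ^ 3)) := by
  have hq2 := norm_sq_lt_one hq
  have hq4 := norm_sq_lt_one hq2
  have h := ((hasProd_qPochhammer hq4 (-(q ^ 2) ^ 2)).pow 3).mul
    ((hasProd_qPochhammer hq2 (-q ^ 2)).pow 6)
  have e1 := oddProduct_mul_qPochhammer_neg hq4
  have e2 := oddProduct_mul_qPochhammer_neg hq2
  have n1 := oddProduct_ne_zero hq2
  have n2 := oddProduct_ne_zero hq4
  convert h using 1
  · funext k
    simp only [burnsideFactorY]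
    ring
  · rw [eq_div_of_mul_eq n1 ((mul_comm _ _).trans e2),
      eq_div_of_mul_eq n2 ((mul_comm _ _).trans e1), ← pow_mul]
    rw [← pow_mul] at n2
    field_simp

/-! ### Power series with integer coefficients -/

/-- The coefficients of `(1 + p^m) ∑ cₙ pⁿ`. -/
def mulOneAddPow (m : ℕ) (c : ℕ → ℕ) (n : ℕ) : ℕ := c n + if m ≤ n then c (n - m) else 0

/-- The coefficients of `∏_{m ∈ l} (1 + p^m)`. -/
def prodCoeff : List ℕ → ℕ → ℕ
  | [], n => if n = 0 then 1 else 0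
  | m :: l, n => mulOneAddPow m (prodCoeff l) n

theorem hasSum_mulOneAddPow {c : ℕ → ℕ} {p f : ℂ} (m : ℕ)
    (h : HasSum (fun n => (c n : ℂ) * p ^ n) f) :
    HasSum (fun n => (mulOneAddPow m c n : ℂ) * p ^ n) ((1 + p ^ m) * f) := by
  have h2 : HasSum (fun n => ((if m ≤ n then c (n - m) else 0 : ℕ) : ℂ) * p ^ n) (p ^ m * f) := by
    refine ((add_left_injective m).hasSum_iff fun n hn => ?_).mp ?_
    · have : ¬ m ≤ n := fun h => hn ⟨n - m, by simp [h]⟩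
      simp [this]
    · have e : (fun n => ((if m ≤ n then c (n - m) else 0 : ℕ) : ℂ) * p ^ n) ∘ (· + m) =
          fun n => p ^ m * ((c n : ℂ) * p ^ n) := by
        funext n
        simp [pow_add]
        ring
      rw [e]
      exact h.mul_left (p ^ m)
  convert h.add h2 using 1
  · funext n
    simp [mulOneAddPow, add_mul]
  · ring

theorem hasSum_prodCoeff (l : List ℕ) (p : ℂ) :
    HasSum (fun n => (prodCoeff l n : ℂ) * p ^ n) (l.map fun m => 1 + p ^ m).prod := by
  induction l with
  | nil =>
    convert hasSum_ite_eq 0 (1 : ℂ) using 2 with n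
    · by_cases h : n = 0 <;> simp [prodCoeff, h]
    · simp
  | cons m l ih => simpa [prodCoeff] using hasSum_mulOneAddPow m ih

theorem le_mulOneAddPow (m : ℕ) (c : ℕ → ℕ) (n : ℕ) : c n ≤ mulOneAddPow m c n :=
  Nat.le_add_right _ _

theorem mulOneAddPow_eq {m n : ℕ} (h : n < m) (c : ℕ → ℕ) : mulOneAddPow m c n = c n := by
  simp [mulOneAddPow, h]

theorem prodCoeff_le_append (l l' : List ℕ) (n : ℕ) :
    prodCoeff l n ≤ prodCoeff (l' ++ l) n := by
  induction l' with
  | nil => rfl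
  | cons m l' ih => exact ih.trans (le_mulOneAddPow _ _ _)

theorem prodCoeff_append_eq {l l' : List ℕ} {n : ℕ} (h : ∀ m ∈ l', n < m) :
    prodCoeff (l' ++ l) n = prodCoeff l n := by
  induction l' with
  | nil => rfl
  | cons m l' ih =>
    rw [List.cons_append, prodCoeff, mulOneAddPow_eq (h m (by simp))]
    exact ih fun k hk => h k (by simp [hk])

/-- The exponents of the first `N` blocks of a product, the last block first. -/
def blocks (B : ℕ → List ℕ) : ℕ → List ℕ
  | 0 => []
  | N + 1 => B N ++ blocks B N

theorem prod_blocks (B : ℕ → List ℕ) (N : ℕ) (p : ℂ) :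
    ((blocks B N).map fun m => 1 + p ^ m).prod =
      ∏ k ∈ Finset.range N, ((B k).map fun m => 1 + p ^ m).prod := by
  induction N with
  | zero => simp [blocks]
  | succ N ih =>
    rw [blocks, List.map_append, List.prod_append, ih, Finset.prod_range_succ, mul_comm]

theorem prodCoeff_blocks_mono (B : ℕ → List ℕ) (n : ℕ) :
    Monotone fun N => prodCoeff (blocks B N) n :=
  monotone_nat_of_le_succ fun _ => prodCoeff_le_append _ _ _

theorem prodCoeff_blocks_eq {B : ℕ → List ℕ} (hB : ∀ k, ∀ m ∈ B k, k < m) {n N : ℕ} (h : n ≤ N) :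
    prodCoeff (blocks B N) n = prodCoeff (blocks B n) n := by
  induction N, h using Nat.le_induction with
  | base => rfl
  | succ N h ih =>
    rw [blocks, prodCoeff_append_eq fun m hm => h.trans_lt (hB N m hm), ih]

/-- An infinite product of factors `1 + p^m` expands into the power series of the stable
coefficients of its partial products. -/
theorem hasSum_prodCoeff_blocks {B : ℕ → List ℕ} (hB : ∀ k, ∀ m ∈ B k, k < m) 
    (hF : ∀ p : ℂ, ‖p‖ < 1 → Multipliable fun k => ((B k).map fun m => 1 + p ^ m).prod)
    {p : ℂ} (hp : ‖p‖ < 1) :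
    HasSum (fun n => (prodCoeff (blocks B n) n : ℂ) * p ^ n)
      (∏' k, ((B k).map fun m => 1 + p ^ m).prod) := by
  -- At a real radius all terms are nonnegative, so the partial sums of the limit series are bounded
  -- by the partial products, which converge and hence are bounded.
  have key : ∀ r : ℝ, 0 ≤ r → r < 1 →
      Summable fun n => (prodCoeff (blocks B n) n : ℝ) * r ^ n := by
    intro r hr0 hr1
    have hr : ‖(r : ℂ)‖ < 1 := by simpa [abs_of_nonneg hr0] using hr1
    have ht := (hF r hr).hasProd.tendsto_prod_nat.norm.bddAbove_range
    obtain ⟨C, hC⟩ := ht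
    refine summable_of_sum_range_le (c := C) (fun n => by positivity) fun M => ?_
    have h1 := hasSum_prodCoeff (blocks B M) r
    rw [prod_blocks] at h1
    have h2 : HasSum (fun n => (prodCoeff (blocks B M) n : ℝ) * r ^ n)
        ‖∏ k ∈ Finset.range M, ((B k).map fun m => 1 + (r : ℂ) ^ m).prod‖ := by
      have h3 := Complex.hasSum_re h1
      have h4 : ∀ n, ((prodCoeff (blocks B M) n : ℂ) * (r : ℂ) ^ n).re =
          (prodCoeff (blocks B M) n : ℝ) * r ^ n := fun n => by
        rw [← Complex.ofReal_pow, ← Complex.ofReal_natCast, ← Complex.ofReal_mul,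
          Complex.ofReal_re]
      simp only [h4] at h3
      have h5 := h3.nonneg fun n => by positivity
      convert h3 using 1
      have h6 : (∏ k ∈ Finset.range M, ((B k).map fun m => 1 + (r : ℂ) ^ m).prod) =
          ((∑' n, (prodCoeff (blocks B M) n : ℝ) * r ^ n : ℝ) : ℂ) := by
        rw [h1.tsum_eq.symm, Complex.ofReal_tsum]
        simp
      rw [h6] at h5 ⊢
      rw [Complex.norm_real, Complex.ofReal_re]
      exact abs_of_nonneg h5
    calc ∑ n ∈ Finset.range M, (prodCoeff (blocks B n) n : ℝ) * r ^ n
        = ∑ n ∈ Finset.range M, (prodCoeff (blocks B M) n : ℝ) * r ^ n := by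
          refine Finset.sum_congr rfl fun n hn => ?_
          rw [prodCoeff_blocks_eq hB (Finset.mem_range.mp hn).le]
      _ ≤ _ := sum_le_hasSum _ (fun n _ => by positivity) h2
      _ ≤ C := hC ⟨M, rfl⟩
  have hs := key ‖p‖ (norm_nonneg _) hp
  have hs' : Summable fun n => (prodCoeff (blocks B n) n : ℂ) * p ^ n :=
    .of_norm (by simpa using hs)
  -- Each coefficient increases with N to its stable value, so the limit series itself is the
  -- dominating series.
  have ht := tendsto_tsum_of_dominated_convergence (𝓕 := Filter.atTop)
    (f := fun N n => (prodCoeff (blocks B N) n : ℂ) * p ^ n)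
    (g := fun n => (prodCoeff (blocks B n) n : ℂ) * p ^ n) hs
    (fun n => tendsto_const_nhds.congr' <| by
      filter_upwards [Filter.eventually_ge_atTop n] with N hN
      rw [prodCoeff_blocks_eq hB hN])
    (.of_forall fun N n => by
      simp only [norm_mul, norm_pow, Complex.norm_natCast]
      gcongr
      rcases le_total n N with h | h
      · rw [prodCoeff_blocks_eq hB h]
      · exact prodCoeff_blocks_mono B n h)
  simp only [(hasSum_prodCoeff _ _).tsum_eq, prod_blocks] at ht
  rw [tendsto_nhds_unique (hF p hp).hasProd.tendsto_prod_nat ht]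
  exact hs'.hasSum

/-- The exponents in `(1 + p^{2(k+1)})² (1 + p^{2k+1})⁴`. -/
def exponentsX (k : ℕ) : List ℕ :=
  [2 * k + 2, 2 * k + 2, 2 * k + 1, 2 * k + 1, 2 * k + 1, 2 * k + 1]

/-- The exponents in `(1 + p^{2(k+1)})³ (1 + p^{k+1})⁶`. -/
def exponentsY (k : ℕ) : List ℕ :=
  [2 * k + 2, 2 * k + 2, 2 * k + 2, k + 1, k + 1, k + 1, k + 1, k + 1, k + 1]

/-- The coefficients `aₙ`. -/
def coeffX (n : ℕ) : ℕ := prodCoeff (blocks exponentsX n) n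

/-- The coefficients `bₙ`. -/
def coeffY (n : ℕ) : ℕ := prodCoeff (blocks exponentsY n) n

theorem coeffX_initial : (List.range 7).map coeffX = [1, 4, 8, 16, 32, 56, 96] := by decide +kernel
theorem coeffY_initial : (List.range 6).map coeffY = [1, 6, 24, 80, 231, 606] := by decide +kernel

theorem exists_sq_eq_norm_lt_one {p : ℂ} (hp : ‖p‖ < 1) : ∃ q : ℂ, q ^ 2 = p ∧ ‖q‖ < 1 := by
  obtain ⟨q, rfl⟩ := IsAlgClosed.exists_pow_nat_eq p two_pos
  refine ⟨q, rfl, ?_⟩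
  rw [norm_pow] at hp
  exact lt_of_pow_lt_pow_left₀ 2 zero_le_one (by simpa using hp)

theorem burnsideFactorX_eq (q : ℂ) :
    burnsideFactorX q = fun k => ((exponentsX k).map fun m => 1 + (q ^ 2) ^ m).prod := by
  funext k
  simp only [burnsideFactorX, exponentsX, List.map_cons, List.map_nil, List.prod_cons,
    List.prod_nil]
  ring

theorem burnsideFactorY_eq (q : ℂ) :
    burnsideFactorY q = fun k => ((exponentsY k).map fun m => 1 + (q ^ 2) ^ m).prod := by
  funext k
  simp only [burnsideFactorY, exponentsY, List.map_cons, List.map_nil, List.prod_cons,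
    List.prod_nil]
  ring

theorem hasSum_coeffX {q : ℂ} (hq : ‖q‖ < 1) :
    HasSum (fun n => (coeffX n : ℂ) * q ^ (2 * n)) (∏' k, burnsideFactorX q k) := by
  simp only [pow_mul]
  rw [burnsideFactorX_eq]
  refine hasSum_prodCoeff_blocks (B := exponentsX) (fun k m hm => ?_) (fun p hp => ?_)
    (norm_sq_lt_one hq)
  · simp [exponentsX] at hm
    omega
  · obtain ⟨q, rfl, hq⟩ := exists_sq_eq_norm_lt_one hp
    rw [← burnsideFactorX_eq]
    exact (hasProd_burnsideFactorX hq).multipliable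

theorem hasSum_coeffY {q : ℂ} (hq : ‖q‖ < 1) :
    HasSum (fun n => (coeffY n : ℂ) * q ^ (2 * n)) (∏' k, burnsideFactorY q k) := by
  simp only [pow_mul]
  rw [burnsideFactorY_eq]
  refine hasSum_prodCoeff_blocks (B := exponentsY) (fun k m hm => ?_) (fun p hp => ?_)
    (norm_sq_lt_one hq)
  · simp [exponentsY] at hm
    omega
  · obtain ⟨q, rfl, hq⟩ := exists_sq_eq_norm_lt_one hp
    rw [← burnsideFactorY_eq]
    exact (hasProd_burnsideFactorY hq).multipliable

/-! ### Even elliptic functions with double poles -/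

open scoped Topology in
/-- An even elliptic function whose only poles are at most double poles at the lattice points is
an affine function of `℘`. -/
theorem PeriodPair.exists_eq_mul_weierstrassP_add (L : PeriodPair) {g h : ℂ → ℂ}
    (hg : ∀ z ∉ L.lattice, AnalyticAt ℂ g z) (hper : ∀ z, ∀ l ∈ L.lattice, g (z + l) = g z)
    (heven : ∀ z, g (-z) = g z) (hh : AnalyticAt ℂ h 0)
    (hgh : ∀ᶠ z in 𝓝[≠] (0 : ℂ), h z = z ^ 2 * g z) :
    ∃ K, ∀ z ∉ L.lattice, g z = h 0 * L.weierstrassP z + K := by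
  classical
  -- This is z²(g - h(0)℘) continued across 0: the double pole of ℘ contributes the constant h(0).
  set k : ℂ → ℂ := fun z => h z - h 0 - h 0 * (z ^ 2 * L.weierstrassPExcept 0 z) with hk
  have hka : AnalyticAt ℂ k 0 := by fun_prop
  have hnot : ∀ᶠ z in 𝓝[≠] (0 : ℂ), z ∉ L.lattice := by
    filter_upwards [self_mem_nhdsWithin, mem_nhdsWithin_of_mem_nhds
      (L.compl_lattice_sdiff_singleton_mem_nhds 0)] with z hz hz'
    simp_all
  have hkg : ∀ᶠ z in 𝓝[≠] (0 : ℂ), k z = z ^ 2 * (g z - h 0 * L.weierstrassP z) := by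
    filter_upwards [hgh, self_mem_nhdsWithin] with z hz hz0
    have e := L.weierstrassPExcept_add 0 z
    simp only [ZeroMemClass.coe_zero, sub_zero] at e
    have hz0 : z ≠ 0 := hz0
    rw [hk]
    simp only [hz, ← e]
    field_simp
    ring
  have hk0 : k 0 = 0 := by simp [hk]
  have hkeven : ∀ᶠ z in 𝓝 (0 : ℂ), k (-z) = k z := by
    have ht : Filter.Tendsto (fun z : ℂ => -z) (𝓝[≠] 0) (𝓝[≠] 0) := by
      refine tendsto_nhdsWithin_of_tendsto_nhds_of_eventually_within _ ?_ ?_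
      · exact ((continuous_neg.tendsto' (0 : ℂ) 0 neg_zero)).mono_left nhdsWithin_le_nhds
      · filter_upwards [self_mem_nhdsWithin] with z hz
        simpa using hz
    have : ∀ᶠ z in 𝓝[≠] (0 : ℂ), k (-z) = k z := by
      filter_upwards [hkg, ht.eventually hkg] with z h1 h2
      rw [h1, h2, heven, L.weierstrassP_neg]
      ring
    rw [eventually_nhdsWithin_iff] at this
    filter_upwards [this] with z hz
    by_cases h0 : z = 0
    · simp [h0]
    · exact hz h0
  -- Evenness excludes a simple pole: k vanishes to order at least 2, so dividing by z² leaves an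
  -- analytic function m.
  have hdk : deriv k 0 = 0 := by
    have e1 : deriv (fun z => k (-z)) 0 = deriv k 0 := Filter.EventuallyEq.deriv_eq hkeven
    rw [deriv_comp_neg, neg_zero] at e1
    exact self_eq_neg.mp e1.symm
  have hord : ((2 : ℕ) : ℕ∞) ≤ analyticOrderAt k 0 := by
    rw [natCast_le_analyticOrderAt_iff_iteratedDeriv_eq_zero hka]
    intro i hi
    interval_cases i
    · simpa using hk0
    · simpa using hdk
  obtain ⟨m, hm, hkm⟩ := (natCast_le_analyticOrderAt hka).mp hord
  set f : ℂ → ℂ := fun z => if z ∈ L.lattice then m 0 else g z - h 0 * L.weierstrassP z with hf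
  have hf0 : AnalyticAt ℂ f 0 := by
    refine hm.congr ?_
    have : ∀ᶠ z in 𝓝[≠] (0 : ℂ), m z = f z := by
      filter_upwards [hkg, mem_nhdsWithin_of_mem_nhds hkm, self_mem_nhdsWithin, hnot]
        with z h1 h2 h3 h4
      have h3 : z ≠ 0 := h3
      rw [h1] at h2
      simp only [hf, if_neg h4]
      simpa [h3] using h2.symm
    rw [eventually_nhdsWithin_iff] at this
    filter_upwards [this] with z hz
    by_cases h0 : z = 0
    · simp [h0, hf]
    · exact hz h0
  have hfper : ∀ z, ∀ l ∈ L.lattice, f (z + l) = f z := by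
    intro z l hl
    have : z + l ∈ L.lattice ↔ z ∈ L.lattice := L.lattice.add_mem_iff_left hl
    simp only [hf, this, hper z l hl, L.weierstrassP_add_coe z ⟨l, hl⟩]
  have hfa : Differentiable ℂ f := by
    intro x
    refine AnalyticAt.differentiableAt ?_
    by_cases hx : x ∈ L.lattice
    · have e : f = fun z => f (z - x) := by
        funext z
        rw [← hfper (z - x) x hx, sub_add_cancel]
      rw [e]
      refine AnalyticAt.fun_comp (g := f) ?_ (by fun_prop)
      simpa using hf0
    · have ha : AnalyticAt ℂ (fun z => g z - h 0 * L.weierstrassP z) x :=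
        (hg x hx).sub (analyticAt_const.mul (L.analyticOnNhd_weierstrassP x hx))
      refine ha.congr ?_
      filter_upwards [L.isClosed_lattice.isOpen_compl.mem_nhds hx] with z hz
      have : z ∉ L.lattice := hz
      simp [hf, this]
  refine ⟨f 0, fun z hz => ?_⟩
  -- Liouville: an entire function periodic under the lattice is bounded.
  have := hfa.apply_eq_apply_of_bounded (IsZLattice.isCompact_range_of_periodic L.lattice f
    hfa.continuous fun z w hw => hfper z w hw).isBounded z 0
  rw [← this]
  simp only [hf, if_neg hz]
  ring

/-! ### Theta products and their quasi-periodicity -/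

/-- The multiplicative theta function `∏_{n ≥ 0} (1 - Qⁿ z) (1 - Q^{n+1} / z)`. -/
noncomputable def thetaProduct (Q z : ℂ) : ℂ := qPochhammer Q z * qPochhammer Q (Q / z)

/-- Isolates the zero at z = 1; the remaining factor is invariant under z ↦ 1/z. -/
theorem thetaProduct_eq {Q : ℂ} (hQ : ‖Q‖ < 1) (z : ℂ) :
    thetaProduct Q z = (1 - z) * (qPochhammer Q (Q * z) * qPochhammer Q (Q / z)) := by
  rw [thetaProduct, qPochhammer_eq hQ z, mul_assoc]

theorem thetaProduct_inv {Q z : ℂ} (hQ : ‖Q‖ < 1) (hz : z ≠ 0) :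
    thetaProduct Q z⁻¹ = -thetaProduct Q z / z := by
  rw [thetaProduct_eq hQ z, thetaProduct_eq hQ z⁻¹, div_inv_eq_mul, ← div_eq_mul_inv]
  field_simp
  ring

theorem thetaProduct_mul {Q z : ℂ} (hQ : ‖Q‖ < 1) (hQ0 : Q ≠ 0) (hz : z ≠ 0) :
    thetaProduct Q (Q * z) = -thetaProduct Q z / z := by
  rw [← thetaProduct_inv hQ hz, thetaProduct, thetaProduct, mul_comm, div_inv_eq_mul,
    div_mul_cancel_left₀ hQ0]

theorem thetaProduct_div_self {Q z : ℂ} (hQ0 : Q ≠ 0) :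
    thetaProduct Q (Q / z) = thetaProduct Q z := by
  rw [thetaProduct, thetaProduct, mul_comm, div_div_cancel₀ hQ0]

theorem thetaProduct_div {Q z : ℂ} (hQ : ‖Q‖ < 1) (hQ0 : Q ≠ 0) (hz : z ≠ 0) :
    thetaProduct Q (z / Q) = -(z / Q) * thetaProduct Q z := by
  have h := thetaProduct_mul hQ hQ0 (div_ne_zero hz hQ0)
  rw [mul_div_cancel₀ _ hQ0] at h
  rw [h]
  field_simp

/-- The multiplicative form of the theta quotient proportional to `℘(u) - ℘(v)`. -/
noncomputable def thetaQuotient (Q w z : ℂ) : ℂ :=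
  thetaProduct Q (z * w) * thetaProduct Q (z / w) / thetaProduct Q z ^ 2

theorem thetaQuotient_inv {Q w z : ℂ} (hQ : ‖Q‖ < 1) (hw : w ≠ 0) (hz : z ≠ 0) :
    thetaQuotient Q w z⁻¹ = thetaQuotient Q w z := by
  have e1 : z⁻¹ * w = (z / w)⁻¹ := by field_simp
  have e2 : z⁻¹ / w = (z * w)⁻¹ := by field_simp
  rw [thetaQuotient, thetaQuotient, e1, e2, thetaProduct_inv hQ (div_ne_zero hz hw),
    thetaProduct_inv hQ (mul_ne_zero hz hw), thetaProduct_inv hQ hz]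
  by_cases h : thetaProduct Q z = 0
  · simp [h]
  · field_simp

/-- The multipliers -1/(zw) and -w/z of the numerator multiply to 1/z², that of the denominator. -/
theorem thetaQuotient_mul {Q w z : ℂ} (hQ : ‖Q‖ < 1) (hQ0 : Q ≠ 0) (hw : w ≠ 0) (hz : z ≠ 0) :
    thetaQuotient Q w (Q * z) = thetaQuotient Q w z := by
  rw [thetaQuotient, thetaQuotient, mul_assoc, mul_div_assoc Q,
    thetaProduct_mul hQ hQ0 (div_ne_zero hz hw),
    thetaProduct_mul hQ hQ0 (mul_ne_zero hz hw), thetaProduct_mul hQ hQ0 hz]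
  -- At a zero of the denominator both sides are 0, by the convention for division by zero.
  by_cases h : thetaProduct Q z = 0
  · simp [h]
  · field_simp

theorem thetaQuotient_zpow_mul {Q w z : ℂ} (hQ : ‖Q‖ < 1) (hQ0 : Q ≠ 0) (hw : w ≠ 0) (hz : z ≠ 0)
    (n : ℤ) : thetaQuotient Q w (Q ^ n * z) = thetaQuotient Q w z := by
  induction n with
  | zero => simp
  | succ n ih =>
    rw [zpow_add_one₀ hQ0, mul_comm (Q ^ (n : ℤ)), mul_assoc,
      thetaQuotient_mul hQ hQ0 hw (mul_ne_zero (zpow_ne_zero _ hQ0) hz), ih]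
  | pred n ih =>
    rw [← ih, ← thetaQuotient_mul hQ hQ0 hw (mul_ne_zero (zpow_ne_zero _ hQ0) hz), ← mul_assoc,
      ← zpow_one_add₀ hQ0]
    congr 3
    ring

/-! ### Theta formulas for differences of ℘ and for ℘' -/

/-- The nome `Q = exp(2πiτ)`. -/
noncomputable def nome (τ : UpperHalfPlane) : ℂ := Complex.exp (2 * Real.pi * Complex.I * τ)

/-- The multiplicative coordinate `exp(πiu/2)` on `ℂ / 4ℤ`. -/
noncomputable def expCoord (u : ℂ) : ℂ := Complex.exp (Real.pi * Complex.I / 2 * u)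

theorem expCoord_ne_zero (u : ℂ) : expCoord u ≠ 0 := Complex.exp_ne_zero _

theorem nome_ne_zero (τ : UpperHalfPlane) : nome τ ≠ 0 := Complex.exp_ne_zero _

theorem norm_nome_lt_one (τ : UpperHalfPlane) : ‖nome τ‖ < 1 := by
  rw [nome, Complex.norm_exp, Real.exp_lt_one_iff]
  have := mul_pos Real.pi_pos τ.im_pos
  simp
  linarith

@[fun_prop]
theorem differentiable_expCoord : Differentiable ℂ expCoord := by
  unfold expCoord
  fun_prop

theorem expCoord_add (u v : ℂ) : expCoord (u + v) = expCoord u * expCoord v := by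
  rw [expCoord, mul_add, Complex.exp_add]
  rfl

theorem expCoord_neg (u : ℂ) : expCoord (-u) = (expCoord u)⁻¹ := by
  rw [expCoord, mul_neg, Complex.exp_neg]
  rfl

theorem expCoord_sub (u v : ℂ) : expCoord (u - v) = expCoord u / expCoord v := by
  rw [sub_eq_add_neg, expCoord_add, expCoord_neg, div_eq_mul_inv]

theorem expCoord_zero : expCoord 0 = 1 := by simp [expCoord]

theorem mem_burnsidePeriods_lattice {τ : UpperHalfPlane} {u : ℂ} :
    u ∈ (burnsidePeriods τ).lattice ↔ ∃ m n : ℤ, m * 4 + n * (4 * (τ : ℂ)) = u :=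
  PeriodPair.mem_lattice

theorem expCoord_lattice (τ : UpperHalfPlane) (m n : ℤ) :
    expCoord (m * 4 + n * (4 * (τ : ℂ))) = nome τ ^ n := by
  rw [nome, ← Complex.exp_int_mul, expCoord, Complex.exp_eq_exp_iff_exists_int]
  exact ⟨m, by ring⟩

theorem mem_lattice_of_nome_zpow_mul_eq_one {τ : UpperHalfPlane} {u : ℂ} {n : ℤ}
    (h : nome τ ^ n * expCoord u = 1) : u ∈ (burnsidePeriods τ).lattice := by
  rw [nome, ← Complex.exp_int_mul, expCoord, ← Complex.exp_add, Complex.exp_eq_one_iff] at h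
  obtain ⟨m, hm⟩ := h
  have hpi : (Real.pi : ℂ) ≠ 0 := by exact_mod_cast Real.pi_ne_zero
  rw [mem_burnsidePeriods_lattice]
  refine ⟨m, -n, ?_⟩
  have h2 : (Real.pi * Complex.I : ℂ) * (m * 4 + (-n : ℤ) * (4 * (τ : ℂ))) =
      (Real.pi * Complex.I : ℂ) * u := by
    push_cast
    linear_combination -2 * hm
  exact mul_left_cancel₀ (mul_ne_zero hpi Complex.I_ne_zero) h2

theorem thetaProduct_expCoord_ne_zero {τ : UpperHalfPlane} {u : ℂ}
    (hu : u ∉ (burnsidePeriods τ).lattice) : thetaProduct (nome τ) (expCoord u) ≠ 0 := by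
  have hQ := norm_nome_lt_one τ
  refine mul_ne_zero (qPochhammer_ne_zero hQ fun n h => hu ?_)
    (qPochhammer_ne_zero hQ fun n h => hu ?_)
  · refine mem_lattice_of_nome_zpow_mul_eq_one (n := n) ?_
    rw [zpow_natCast]
    exact (sub_eq_zero.mp h).symm
  · rw [← neg_neg u]
    refine Submodule.neg_mem _ (mem_lattice_of_nome_zpow_mul_eq_one (n := n + 1) ?_)
    rw [expCoord_neg, zpow_add_one₀ (nome_ne_zero τ), zpow_natCast, mul_assoc, ← div_eq_mul_inv]
    exact (sub_eq_zero.mp h).symm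

theorem differentiable_thetaProduct_expCoord (τ : UpperHalfPlane) {f : ℂ → ℂ}
    (hf : Differentiable ℂ f) :
    Differentiable ℂ fun u => thetaProduct (nome τ) (expCoord (f u)) := by
  have hQ := norm_nome_lt_one τ
  have e : (fun u => thetaProduct (nome τ) (expCoord (f u))) = fun u =>
      qPochhammer (nome τ) (expCoord (f u)) * qPochhammer (nome τ) (nome τ * expCoord (-f u)) := by
    funext u
    rw [thetaProduct, expCoord_neg, div_eq_mul_inv]
  rw [e]
  exact (differentiable_qPochhammer_comp hQ (differentiable_expCoord.comp hf)).mul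
    (differentiable_qPochhammer_comp hQ
      ((differentiable_const _).mul (differentiable_expCoord.comp hf.neg)))

/-- The factor `K` in the product formula for `℘(u) - ℘(v)`. -/
noncomputable def weierstrassConst (τ : UpperHalfPlane) : ℂ :=
  (Real.pi / 2) ^ 2 * qPochhammer (nome τ) (nome τ) ^ 4

theorem hasDerivAt_one_sub_expCoord :
    HasDerivAt (fun u => 1 - expCoord u) (-(Real.pi * Complex.I / 2)) 0 := by
  have := (((hasDerivAt_id (0 : ℂ)).const_mul (Real.pi * Complex.I / 2 : ℂ)).cexp).const_sub 1
  simpa [expCoord] using! this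

open scoped Topology in
/-- The product formula for the differences of values of `℘`. -/
theorem weierstrassP_sub (τ : UpperHalfPlane) {u v : ℂ}
    (hu : u ∉ (burnsidePeriods τ).lattice) (hv : v ∉ (burnsidePeriods τ).lattice) :
    (burnsidePeriods τ).weierstrassP u - (burnsidePeriods τ).weierstrassP v =
      weierstrassConst τ * (expCoord v * thetaProduct (nome τ) (expCoord u * expCoord v) *
        thetaProduct (nome τ) (expCoord u / expCoord v)) /
        (thetaProduct (nome τ) (expCoord u) ^ 2 * thetaProduct (nome τ) (expCoord v) ^ 2) := by
  have hQ := norm_nome_lt_one τ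
  have hQ0 := nome_ne_zero τ
  set Q := nome τ with hQdef
  set g : ℂ → ℂ := fun u => thetaQuotient Q (expCoord v) (expCoord u) with hg
  set c : ℂ := Real.pi * Complex.I / 2 with hc
  have hc0 : c ≠ 0 := by simp [hc, Real.pi_ne_zero]
  have hφ : qPochhammer Q Q ≠ 0 := qPochhammer_ne_zero_of_norm_lt hQ hQ
  have hθv : thetaProduct Q (expCoord v) ≠ 0 := thetaProduct_expCoord_ne_zero hv
  -- m(u) continues (1 - exp(πiu/2))/u, so that theta is u·m(u)·ψ(u) and the double pole of g at 0
  -- is explicit.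
  set m : ℂ → ℂ := dslope (fun u => 1 - expCoord u) 0 with hm
  have hmd : Differentiable ℂ m := by
    rw [← differentiableOn_univ, hm, Complex.differentiableOn_dslope Filter.univ_mem]
    exact (by fun_prop : Differentiable ℂ fun u => 1 - expCoord u).differentiableOn
  have hm0 : m 0 = -c := by
    rw [hm, dslope_same]
    exact hasDerivAt_one_sub_expCoord.deriv
  have hm1 : ∀ u, u * m u = 1 - expCoord u := fun u => by
    simpa [expCoord_zero] using sub_smul_dslope (fun u => 1 - expCoord u) 0 u
  set ψ : ℂ → ℂ := fun u => qPochhammer Q (Q * expCoord u) * qPochhammer Q (Q * expCoord (-u))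
    with hψ
  have hψd : Differentiable ℂ ψ := by
    have := differentiable_expCoord
    exact (differentiable_qPochhammer_comp hQ (by fun_prop)).mul
      (differentiable_qPochhammer_comp hQ (by fun_prop))
  have hψ0 : ψ 0 = qPochhammer Q Q ^ 2 := by
    simp [hψ, expCoord_zero, sq]
  have hθ : ∀ u, thetaProduct Q (expCoord u) = u * m u * ψ u := fun u => by
    simp only [thetaProduct_eq hQ, hm1, hψ, expCoord_neg, div_eq_mul_inv]
  set N : ℂ → ℂ := fun u =>
    thetaProduct Q (expCoord (u + v)) * thetaProduct Q (expCoord (u - v)) with hN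
  have hNd : Differentiable ℂ N :=
    (differentiable_thetaProduct_expCoord τ (by fun_prop)).mul
      (differentiable_thetaProduct_expCoord τ (by fun_prop))
  have hgN : ∀ u, g u = N u / thetaProduct Q (expCoord u) ^ 2 := fun u => by
    simp only [hg, hN, thetaQuotient, expCoord_add, expCoord_sub]
  set h : ℂ → ℂ := fun u => N u / (m u * ψ u) ^ 2 with hh
  obtain ⟨K, hK⟩ := (burnsidePeriods τ).exists_eq_mul_weierstrassP_add (g := g) (h := h)
    (fun z hz => by
      simp only [funext hgN]
      exact (hNd.analyticAt z).div
        ((differentiable_thetaProduct_expCoord τ differentiable_id).analyticAt z |>.pow 2)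
        (pow_ne_zero 2 (thetaProduct_expCoord_ne_zero hz)))
    (fun z l hl => by
      obtain ⟨a, b, rfl⟩ := mem_burnsidePeriods_lattice.mp hl
      simp only [hg]
      rw [expCoord_add, expCoord_lattice, mul_comm,
        thetaQuotient_zpow_mul hQ hQ0 (expCoord_ne_zero _) (expCoord_ne_zero _)])
    (fun z => by
      simp only [hg]
      rw [expCoord_neg, thetaQuotient_inv hQ (expCoord_ne_zero _) (expCoord_ne_zero _)])
    ((hNd.analyticAt 0).div (((hmd.mul hψd).analyticAt 0).pow 2)
      (pow_ne_zero 2 (by simp [hm0, hψ0, hc0, hφ])))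
    (by
      filter_upwards [self_mem_nhdsWithin] with z hz
      have hz : z ≠ 0 := hz
      rw [hgN, hθ, hh]
      field_simp)
  -- The zero of g at u = v eliminates the additive constant K.
  have hgv : g v = 0 := by
    rw [hgN, hN]
    simp [expCoord_zero, thetaProduct_eq hQ 1]
  have h0 : h 0 = thetaProduct Q (expCoord v) ^ 2 / (weierstrassConst τ * expCoord v) := by
    have h1 := expCoord_ne_zero v
    have h2 : (Real.pi : ℂ) ≠ 0 := by simp [Real.pi_ne_zero]
    simp only [hh, hN, hm0, hψ0, zero_add, zero_sub, expCoord_neg, thetaProduct_inv hQ h1,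
      weierstrassConst, hc, ← hQdef]
    field_simp
    simp
  have e := (hK u hu).symm.trans (hgN u)
  have e' := (hK v hv).symm.trans hgv
  have e2 : h 0 * ((burnsidePeriods τ).weierstrassP u - (burnsidePeriods τ).weierstrassP v) =
      N u / thetaProduct Q (expCoord u) ^ 2 := by linear_combination e - e'
  have hW : weierstrassConst τ ≠ 0 := by
    simp [weierstrassConst, Real.pi_ne_zero, hφ, ← hQdef]
  have h1 := expCoord_ne_zero v
  have hθu : thetaProduct Q (expCoord u) ≠ 0 := thetaProduct_expCoord_ne_zero hu
  simp only [h0, hN, expCoord_add, expCoord_sub] at e2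
  field_simp at e2 ⊢
  linear_combination e2
open scoped Topology in
-- Near v the product formula reads A(u)(1 - exp(πi(u - v)/2)). The second factor vanishes at v, so
-- the derivative there is A(v) times -πi/2.
theorem derivWeierstrassP_eq (τ : UpperHalfPlane) {v : ℂ} (hv : v ∉ (burnsidePeriods τ).lattice) :
    (burnsidePeriods τ).derivWeierstrassP v =
      -(Real.pi * Complex.I / 2) * qPochhammer (nome τ) (nome τ) ^ 2 * weierstrassConst τ *
        (expCoord v * thetaProduct (nome τ) (expCoord v ^ 2)) /
        thetaProduct (nome τ) (expCoord v) ^ 4 := by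
  have hQ := norm_nome_lt_one τ
  have hθv := thetaProduct_expCoord_ne_zero hv
  set A : ℂ → ℂ := fun u => weierstrassConst τ * (expCoord v *
    thetaProduct (nome τ) (expCoord (u + v))) / (thetaProduct (nome τ) (expCoord u) ^ 2 *
      thetaProduct (nome τ) (expCoord v) ^ 2) *
      (qPochhammer (nome τ) (nome τ * expCoord (u - v)) *
        qPochhammer (nome τ) (nome τ * expCoord (v - u))) with hA
  have hd := differentiable_expCoord
  have hAd : DifferentiableAt ℂ A v := by
    refine DifferentiableAt.mul (DifferentiableAt.div ?_ ?_ ?_) (DifferentiableAt.mul ?_ ?_)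
    · exact (differentiableAt_const _).mul ((differentiableAt_const _).mul
        (differentiable_thetaProduct_expCoord τ (by fun_prop) v))
    · exact ((differentiable_thetaProduct_expCoord τ differentiable_id v).pow 2).mul
        (differentiableAt_const _)
    · exact mul_ne_zero (pow_ne_zero 2 hθv) (pow_ne_zero 2 hθv)
    · exact differentiable_qPochhammer_comp hQ (by fun_prop) v
    · exact differentiable_qPochhammer_comp hQ (by fun_prop) v
  have hB : HasDerivAt (fun u => 1 - expCoord (u - v)) (-(Real.pi * Complex.I / 2)) v := by
    refine HasDerivAt.comp_sub_const v v (f := fun u => 1 - expCoord u) ?_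
    rw [sub_self]
    exact hasDerivAt_one_sub_expCoord
  have hAB := hAd.hasDerivAt.mul hB
  have e : (fun u => (burnsidePeriods τ).weierstrassP u - (burnsidePeriods τ).weierstrassP v)
      =ᶠ[𝓝 v] fun u => A u * (1 - expCoord (u - v)) := by
    filter_upwards [(burnsidePeriods τ).isClosed_lattice.isOpen_compl.mem_nhds hv] with u hu
    rw [weierstrassP_sub τ hu hv, ← expCoord_sub, thetaProduct_eq hQ (expCoord (u - v)),
      ← expCoord_add, div_eq_mul_inv (nome τ), ← expCoord_neg, neg_sub]
    ring
  have hd := (hAB.congr_of_eventuallyEq e).deriv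
  rw [deriv_sub_const, PeriodPair.deriv_weierstrassP] at hd
  rw [hd, hA]
  simp only [sub_self, expCoord_zero, mul_one, mul_zero, zero_add, expCoord_add]
  field_simp

/-! ### Special values and Jacobi's identity -/

/-- Reduces non-membership for rational coordinates to arithmetic: a/4 and b/4 must not both be
integers. -/
theorem notMem_burnsidePeriods_lattice (τ : UpperHalfPlane) (a b : ℚ)
    (h : ¬((a / 4).den = 1 ∧ (b / 4).den = 1)) :
    (a : ℂ) + b * τ ∉ (burnsidePeriods τ).lattice := by
  rw [← PeriodPair.mul_ω₁_add_mul_ω₂_mem_lattice (L := burnsidePeriods τ)] at h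
  convert h using 2
  simp only [burnsidePeriods]
  push_cast
  ring

theorem expCoord_one : expCoord 1 = Complex.I := by
  rw [expCoord, mul_one, mul_div_right_comm, Complex.exp_pi_div_two_mul_I]

theorem expCoord_two : expCoord 2 = -1 := by
  rw [← one_add_one_eq_two, expCoord_add, expCoord_one, Complex.I_mul_I]

theorem expCoord_int_mul (n : ℤ) (u : ℂ) : expCoord (n * u) = expCoord u ^ n := by
  rw [expCoord, expCoord, ← Complex.exp_int_mul]
  congr 1
  ring

theorem expCoord_nat_mul (n : ℕ) (u : ℂ) : expCoord (n * u) = expCoord u ^ n := by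
  exact_mod_cast expCoord_int_mul n u

theorem nome_eq_pow (τ : UpperHalfPlane) : nome τ = expCoord τ ^ 4 := by
  rw [nome, ← expCoord_nat_mul, expCoord]
  congr 1
  push_cast
  ring

theorem norm_expCoord_lt_one (τ : UpperHalfPlane) : ‖expCoord τ‖ < 1 := by
  rw [expCoord, Complex.norm_exp, Real.exp_lt_one_iff]
  have := mul_pos Real.pi_pos τ.im_pos
  simp
  linarith

theorem exists_expCoord_two_mul_eq {p : ℂ} (hp : ‖p‖ < 1) (hp0 : p ≠ 0) :
    ∃ τ : UpperHalfPlane, expCoord (2 * τ) = p := by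
  have hpi : (Real.pi : ℂ) ≠ 0 := by simp [Real.pi_ne_zero]
  refine ⟨⟨Complex.log p / (Real.pi * Complex.I), ?_⟩, ?_⟩
  · have : Real.log ‖p‖ < 0 := Real.log_neg (norm_pos_iff.mpr hp0) hp
    have e : Complex.log p / (Real.pi * Complex.I) =
        -(Complex.log p / (Real.pi : ℝ)) * Complex.I := by
      field_simp
      simp
    rw [e, Complex.mul_I_im, Complex.neg_re, Complex.div_ofReal_re, Complex.log_re, ← neg_div]
    exact div_pos (neg_pos.mpr this) Real.pi_pos
  · rw [expCoord]
    conv_rhs => rw [← Complex.exp_log hp0]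
    congr 1
    field_simp

theorem thetaProduct_sq_self (s : ℂ) : thetaProduct (s ^ 2) s = oddProduct s ^ 2 := by
  by_cases h : s = 0
  · simp [h, thetaProduct, oddProduct, sq]
  · rw [thetaProduct, oddProduct, sq s, mul_div_cancel_left₀ _ h, sq]

theorem thetaProduct_neg_one {Q : ℂ} (hQ : ‖Q‖ < 1) :
    thetaProduct Q (-1) = 2 / oddProduct Q ^ 2 := by
  have h := oddProduct_mul_qPochhammer_neg hQ
  have h0 := oddProduct_ne_zero hQ
  rw [thetaProduct_eq hQ, mul_neg_one, div_neg, div_one, eq_div_iff (pow_ne_zero 2 h0)]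
  linear_combination 2 * (oddProduct Q * qPochhammer Q (-Q) + 1) * h

theorem weierstrassConst_ne_zero (τ : UpperHalfPlane) : weierstrassConst τ ≠ 0 := by
  simp [weierstrassConst, Real.pi_ne_zero,
    qPochhammer_ne_zero_of_norm_lt (norm_nome_lt_one τ) (norm_nome_lt_one τ)]

/-- Jacobi's quartic identity. -/
theorem oddProduct_neg_pow_eight {p : ℂ} (hp : ‖p‖ < 1) :
    oddProduct (-p) ^ 8 = oddProduct p ^ 8 + 16 * p / oddProduct (p ^ 2) ^ 8 := by
  by_cases hp0 : p = 0
  · simp [hp0]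
  obtain ⟨τ, rfl⟩ := exists_expCoord_two_mul_eq hp hp0
  set s := expCoord (2 * τ) with hs
  have hQ := norm_nome_lt_one τ
  have hQ0 := nome_ne_zero τ
  have hQs : nome τ = s ^ 2 := by
    rw [nome_eq_pow, hs, ← expCoord_nat_mul, ← expCoord_nat_mul]
    congr 1
    push_cast
    ring
  -- At the half-periods 2, 2τ and 2 + 2τ, whose coordinates are -1, s and -s, the relation (℘₁ -
  -- ℘₃) + (℘₃ - ℘₂) = ℘₁ - ℘₂ becomes the identity in theta constants of base s².
  have m1 : (2 : ℂ) ∉ (burnsidePeriods τ).lattice := by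
    simpa using notMem_burnsidePeriods_lattice τ 2 0 (by norm_num)
  have m2 : 2 * (τ : ℂ) ∉ (burnsidePeriods τ).lattice := by
    simpa using notMem_burnsidePeriods_lattice τ 0 2 (by norm_num)
  have m3 : 2 + 2 * (τ : ℂ) ∉ (burnsidePeriods τ).lattice := by
    simpa using notMem_burnsidePeriods_lattice τ 2 2 (by norm_num)
  have d1 := weierstrassP_sub τ m1 m2
  have d2 := weierstrassP_sub τ m1 m3
  have d3 := weierstrassP_sub τ m3 m2
  have n1 := thetaProduct_expCoord_ne_zero m1
  have n2 := thetaProduct_expCoord_ne_zero m2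
  have n3 := thetaProduct_expCoord_ne_zero m3
  have hK := weierstrassConst_ne_zero τ
  have i1 : thetaProduct (nome τ) (-1 / s) = thetaProduct (nome τ) (-s) / s := by
    have := thetaProduct_inv hQ (neg_ne_zero.mpr hp0)
    rw [inv_neg, neg_div_neg_eq] at this
    rw [neg_div, one_div, this]
  have i2 : thetaProduct (nome τ) (-1 / (-1 * s)) = -thetaProduct (nome τ) s / s := by
    rw [← thetaProduct_inv hQ hp0]
    congr 1
    field_simp
  have i3 : thetaProduct (nome τ) (-1 * s * s) = thetaProduct (nome τ) (-1) := by
    have := thetaProduct_mul hQ hQ0 (z := -1) (by simp)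
    rw [neg_div_neg_eq, div_one] at this
    rw [← this, hQs]
    congr 1
    ring
  have i4 : -1 * s / s = -1 := by field_simp
  have i5 : -1 * (-1 * s) = s := by ring
  rw [expCoord_add, expCoord_two, ← hs] at d2 d3 n3
  rw [expCoord_two, ← hs] at d1
  rw [expCoord_two] at n1
  rw [i1] at d1
  rw [i2, i5] at d2
  rw [i3, i4] at d3
  simp only [neg_one_mul] at d1 d2 d3 n3
  have key : thetaProduct (nome τ) (-s) ^ 4 =
      thetaProduct (nome τ) s ^ 4 + s * thetaProduct (nome τ) (-1) ^ 4 := by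
    have e : weierstrassConst τ *
        (s * thetaProduct (nome τ) (-s) * (thetaProduct (nome τ) (-s) / s)) /
        (thetaProduct (nome τ) (-1) ^ 2 * thetaProduct (nome τ) s ^ 2) = _ + _ :=
      d1.symm.trans ((sub_add_sub_cancel _ _ _).symm.trans (congrArg₂ (· + ·) d2 d3))
    rw [← hs] at n2
    field_simp at e
    linear_combination e
  have t1 : thetaProduct (s ^ 2) (-s) = oddProduct (-s) ^ 2 := by
    rw [← thetaProduct_sq_self, neg_sq]
  rw [hQs, t1, thetaProduct_sq_self, thetaProduct_neg_one (norm_sq_lt_one hp)] at key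
  have := oddProduct_ne_zero (norm_sq_lt_one hp)
  field_simp at key ⊢
  linear_combination key

/-! ### Change of lattice basis and Burnside's x at the four cusps -/

/-- Homogeneity of degree -2: multiplication by j reindexes the lattice sum. -/
theorem PeriodPair.weierstrassP_mul {L L' : PeriodPair} {j : ℂ} (hj : j ≠ 0)
    (h : ∀ z, j * z ∈ L.lattice ↔ z ∈ L'.lattice) (z : ℂ) :
    L.weierstrassP (j * z) = L'.weierstrassP z / j ^ 2 := by
  let e : L'.lattice ≃ L.lattice := (Equiv.mulLeft₀ j hj).subtypeEquiv fun z => (h z).symm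
  rw [weierstrassP, weierstrassP, ← e.tsum_eq, ← tsum_div_const]
  refine tsum_congr fun l => ?_
  have : ((e l : L.lattice) : ℂ) = j * l := rfl
  rw [this, ← mul_sub, mul_pow, mul_pow, sub_div]
  simp only [mul_inv, div_eq_mul_inv]
  ring

/-- With j = cτ + d, the numbers 4j and 4jτ' = 4(aτ + b) form another basis of the lattice, because
the determinant is 1. -/
theorem burnsidePeriods_mul_mem {τ τ' : UpperHalfPlane} {a b c d : ℤ} (hdet : a * d - b * c = 1)
    (hj : (c * (τ : ℂ) + d : ℂ) ≠ 0) (hτ : (c * (τ : ℂ) + d) * (τ' : ℂ) = a * (τ : ℂ) + b)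
    (z : ℂ) : (c * (τ : ℂ) + d) * z ∈ (burnsidePeriods τ).lattice ↔
      z ∈ (burnsidePeriods τ').lattice := by
  have hdet' : (a * d - b * c : ℂ) = 1 := by exact_mod_cast hdet
  simp only [mem_burnsidePeriods_lattice]
  constructor
  · rintro ⟨m, n, h⟩
    refine ⟨m * a - n * b, n * d - m * c, mul_left_cancel₀ hj ?_⟩
    push_cast
    linear_combination h + 4 * (n * d - m * c) * hτ + (4 * n * τ + 4 * m) * hdet'
  · rintro ⟨m, n, rfl⟩
    refine ⟨m * d + n * b, m * c + n * a, ?_⟩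
    push_cast
    linear_combination (-4 * n) * hτ

/-- Burnside's `x` in terms of theta products, after a change of basis of the period lattice. -/
theorem burnsideX_eq_thetaProduct {τ τ' : UpperHalfPlane} {a b c d : ℤ} (hdet : a * d - b * c = 1)
    (hτ : (c * (τ : ℂ) + d) * (τ' : ℂ) = a * (τ : ℂ) + b) {p z w : ℂ} (hp : p = expCoord τ')
    (hz : z = Complex.I ^ a * p ^ (-c)) (hw : w = Complex.I ^ (-b) * p ^ d) :
    burnsideX τ = thetaProduct (p ^ 4) (z ^ 3) * thetaProduct (p ^ 4) z⁻¹ *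
      thetaProduct (p ^ 4) w ^ 2 / (thetaProduct (p ^ 4) z ^ 2 *
        (thetaProduct (p ^ 4) (w * z ^ 2) * thetaProduct (p ^ 4) (w / z ^ 2))) := by
  have hj : (c * (τ : ℂ) + d) ≠ 0 := by
    intro h
    have him := congrArg Complex.im h
    simp [τ.im_ne_zero] at him
    simp [him] at h
    simp [him, h] at hdet
  have hdet' : (a * d - b * c : ℂ) = 1 := by exact_mod_cast hdet
  set j := c * (τ : ℂ) + d with hjdef
  have hmem := burnsidePeriods_mul_mem hdet hj hτ
  have hP := PeriodPair.weierstrassP_mul hj hmem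
  -- Inverting the basis change gives 1 = j(a - cτ') and τ = j(dτ' - b).
  set u : ℂ := a - c * τ' with hu
  have hju : j * u = 1 := by
    rw [hu, hjdef]
    linear_combination hdet' - c * hτ
  have hjA : j * (d * τ' - b) = τ := by
    linear_combination d * hτ + (τ : ℂ) * hdet' - b * hjdef
  have m1 : u ∉ (burnsidePeriods τ').lattice := by
    rw [← hmem, hju]
    simpa using notMem_burnsidePeriods_lattice τ 1 0 (by norm_num)
  have m2 : 2 * u ∉ (burnsidePeriods τ').lattice := by
    rw [← hmem, mul_left_comm, hju]
    simpa using notMem_burnsidePeriods_lattice τ 2 0 (by norm_num)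
  have m3 : d * (τ' : ℂ) - b ∉ (burnsidePeriods τ').lattice := by
    rw [← hmem, hjA]
    simpa using notMem_burnsidePeriods_lattice τ 0 1 (by norm_num)
  have e1 : expCoord u = z := by
    rw [hz, hp, hu, sub_eq_add_neg, expCoord_add, ← neg_mul, ← mul_one (a : ℂ), expCoord_int_mul,
      expCoord_one, ← Int.cast_neg, expCoord_int_mul]
  have e2 : expCoord (2 * u) = z ^ 2 := by
    rw [← e1, ← expCoord_nat_mul, Nat.cast_ofNat]
  have e3 : expCoord (d * (τ' : ℂ) - b) = w := by
    rw [hw, hp, sub_eq_add_neg, add_comm, expCoord_add, ← mul_one (-b : ℂ), ← Int.cast_neg,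
      expCoord_int_mul, expCoord_one, expCoord_int_mul]
  have hz0 : z ≠ 0 := e1 ▸ expCoord_ne_zero u
  have hQ : nome τ' = p ^ 4 := by rw [nome_eq_pow, hp]
  have d1 := weierstrassP_sub τ' m1 m2
  have d2 := weierstrassP_sub τ' m3 m2
  have n1 := thetaProduct_expCoord_ne_zero m1
  have n2 := thetaProduct_expCoord_ne_zero m2
  have n3 := thetaProduct_expCoord_ne_zero m3
  have hK := weierstrassConst_ne_zero τ'
  rw [e1, e2, hQ] at d1
  rw [e3, e2, hQ] at d2
  rw [e1, hQ] at n1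
  rw [e2, hQ] at n2
  rw [e3, hQ] at n3
  have f1 : z * z ^ 2 = z ^ 3 := by ring
  have f2 : z / z ^ 2 = z⁻¹ := by field_simp
  rw [f1, f2] at d1
  have g1 : (burnsidePeriods τ).weierstrassP 1 = (burnsidePeriods τ').weierstrassP u / j ^ 2 := by
    rw [← hP, hju]
  have g2 : (burnsidePeriods τ).weierstrassP 2 =
      (burnsidePeriods τ').weierstrassP (2 * u) / j ^ 2 := by
    rw [← hP, mul_left_comm, hju, mul_one]
  have g3 : (burnsidePeriods τ).weierstrassP τ =
      (burnsidePeriods τ').weierstrassP (d * τ' - b) / j ^ 2 := by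
    rw [← hP, hjA]
  simp only [burnsideX]
  rw [g1, g2, g3, ← sub_div, ← sub_div, div_div_div_cancel_right₀ (pow_ne_zero 2 hj), d1, d2]
  field_simp

theorem BurnsideCusp.exists_upperHalfPlane (c : BurnsideCusp) (τ : UpperHalfPlane) :
    ∃ τ' : UpperHalfPlane, (τ' : ℂ) = c.moebius τ := by
  have key : ∀ γ : Matrix.SpecialLinearGroup (Fin 2) ℤ, ∃ τ' : UpperHalfPlane, (τ' : ℂ) =
      (γ 0 0 * (τ : ℂ) + γ 0 1) / (γ 1 0 * (τ : ℂ) + γ 1 1) := fun γ =>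
    ⟨γ • τ, by simpa using UpperHalfPlane.coe_specialLinearGroup_apply γ τ⟩
  cases c with
  | half =>
    simpa [moebius, sub_eq_add_neg] using key ⟨!![3, -2; 2, -1], by simp [Matrix.det_fin_two]⟩
  | infty =>
    simpa [moebius, sub_eq_add_neg] using key ⟨!![1, -2; 0, 1], by simp [Matrix.det_fin_two]⟩
  | one =>
    simpa [moebius, sub_eq_add_neg] using key ⟨!![1, -2; 1, -1], by simp [Matrix.det_fin_two]⟩
  | negOne =>
    simpa [moebius, sub_eq_add_neg] using key ⟨!![3, 2; 1, 1], by simp [Matrix.det_fin_two]⟩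

theorem BurnsideCusp.q_sq {c : BurnsideCusp} {τ τ' : UpperHalfPlane} (h : (τ' : ℂ) = c.moebius τ) :
    c.q τ ^ 2 = expCoord τ' := by
  rw [q, ← h, expCoord, ← Complex.exp_nat_mul]
  congr 1
  push_cast
  ring

theorem BurnsideCusp.norm_q_lt_one (c : BurnsideCusp) (τ : UpperHalfPlane) : ‖c.q τ‖ < 1 := by
  obtain ⟨τ', h⟩ := c.exists_upperHalfPlane τ
  have := norm_expCoord_lt_one τ'
  rw [← q_sq h, norm_pow] at this
  exact lt_of_pow_lt_pow_left₀ 2 zero_le_one (by simpa using this)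

/-- The two factors collect the exponents congruent to 1 and to 3 modulo 4. -/
theorem thetaProduct_pow_four_self {p : ℂ} (hp : ‖p‖ < 1) (hp0 : p ≠ 0) :
    thetaProduct (p ^ 4) p = oddProduct p := by
  have := qPochhammer_even_mul_odd (norm_sq_lt_one hp) p
  rw [oddProduct, ← this, thetaProduct]
  congr 2
  · ring
  · ring
  · field_simp

theorem burnsideX_eq (c : BurnsideCusp) (τ : UpperHalfPlane) :
    burnsideX τ = c.branchValue *
      (oddProduct (c.q τ ^ 4) ^ 2 / oddProduct (c.q τ ^ 2) ^ 4) := by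
  obtain ⟨τ', h⟩ := c.exists_upperHalfPlane τ
  have hq2 := c.q_sq h
  have hq4 : c.q τ ^ 4 = expCoord τ' ^ 2 := by rw [← hq2]; ring
  rw [hq2, hq4]
  have hp := norm_expCoord_lt_one τ'
  have hp0 := expCoord_ne_zero τ'
  generalize hpe : expCoord τ' = p at hp hp0 hq2 ⊢
  have hQ : ‖p ^ 4‖ < 1 := by
    rw [norm_pow]; exact pow_lt_one₀ (norm_nonneg _) hp four_ne_zero
  have hQ0 : p ^ 4 ≠ 0 := pow_ne_zero 4 hp0
  have t1 := thetaProduct_pow_four_self hp hp0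
  have t2 := thetaProduct_pow_four_self (p := -p) (by simpa using hp) (by simpa using hp0)
  rw [Even.neg_pow (by decide)] at t2
  have hmul := oddProduct_mul_neg hp
  have n1 := oddProduct_ne_zero hp
  -- With p = q² the target is e·θ(-p)²/θ(p)² in base p⁴. At each cusp the auxiliary factors θ(z)
  -- cancel, and the multipliers from `hinv` and `hdiv` leave exactly e.
  have hred : c.branchValue * (oddProduct (p ^ 2) ^ 2 / oddProduct p ^ 4) =
      c.branchValue * (thetaProduct (p ^ 4) (-p) ^ 2 / thetaProduct (p ^ 4) p ^ 2) := by
    rw [t1, t2, ← hmul]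
    field_simp
  have hne : ∀ a b : ℚ, ¬((a / 4).den = 1 ∧ (b / 4).den = 1) → ∀ z, z = expCoord (a + b * τ') →
      thetaProduct (p ^ 4) z ≠ 0 := fun a b hab z hz => by
    rw [← hpe, ← nome_eq_pow, hz]
    exact thetaProduct_expCoord_ne_zero (notMem_burnsidePeriods_lattice τ' a b hab)
  have I0 := Complex.I_ne_zero
  have I2 := Complex.I_sq
  have I3 := Complex.I_pow_three
  have n3 : thetaProduct (p ^ 4) p ≠ 0 := t1 ▸ n1
  have hinv : ∀ z, z ≠ 0 → thetaProduct (p ^ 4) z⁻¹ = -thetaProduct (p ^ 4) z / z :=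
    fun z hz => thetaProduct_inv hQ hz
  have hdiv : ∀ z, z ≠ 0 → thetaProduct (p ^ 4) (z / p ^ 4) =
      -(z / p ^ 4) * thetaProduct (p ^ 4) z :=
    fun z hz => thetaProduct_div hQ hQ0 hz
  rw [hred]
  cases c with
  | infty =>
    have hτ : ((0 : ℤ) * (τ : ℂ) + (1 : ℤ)) * (τ' : ℂ) = (1 : ℤ) * (τ : ℂ) + (-2 : ℤ) := by
      rw [h, BurnsideCusp.moebius]
      push_cast
      ring
    rw [burnsideX_eq_thetaProduct (by norm_num) hτ hpe.symm (z := Complex.I) (w := -p) (by simp)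
      (by simp [zpow_ofNat])]
    have nI := hne 1 0 (by norm_num) Complex.I (by simp [expCoord_one])
    have e1 : Complex.I ^ 3 = Complex.I⁻¹ := by rw [I3, Complex.inv_I]
    have e2 : -p * Complex.I ^ 2 = p := by rw [I2]; ring
    have e3 : -p / Complex.I ^ 2 = p := by rw [I2]; ring
    rw [e1, e2, e3, hinv _ I0, BurnsideCusp.branchValue]
    field_simp
    rw [I2]
    ring
  | half =>
    have hd : 2 * (τ : ℂ) - 1 ≠ 0 := fun h => by
      simpa [τ.im_ne_zero] using congrArg Complex.im h
    have hτ : ((2 : ℤ) * (τ : ℂ) + (-1 : ℤ)) * (τ' : ℂ) = (3 : ℤ) * (τ : ℂ) + (-2 : ℤ) := by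
      rw [h, BurnsideCusp.moebius]
      push_cast
      rw [← sub_eq_add_neg, ← sub_eq_add_neg, mul_div_cancel₀ _ hd]
    rw [burnsideX_eq_thetaProduct (by norm_num) hτ hpe.symm (z := (Complex.I * p ^ 2)⁻¹)
      (w := (-p)⁻¹) (by simp [zpow_ofNat, zpow_neg, I3, mul_comm]) (by simp [zpow_ofNat, inv_neg])]
    have z0 : Complex.I * p ^ 2 ≠ 0 := by simp [hp0]
    have n0 := hne 1 2 (by norm_num) (Complex.I * p ^ 2) (by
      have := expCoord_nat_mul 2 τ'
      push_cast at this ⊢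
      rw [expCoord_add, this, expCoord_one, hpe])
    have e1 : (Complex.I * p ^ 2)⁻¹ ^ 3 = Complex.I * p ^ 2 / p ^ 4 / p ^ 4 := by
      field_simp
      rw [Complex.I_pow_four]
    have e2 : (-p)⁻¹ * (Complex.I * p ^ 2)⁻¹ ^ 2 = p⁻¹ / p ^ 4 := by
      field_simp
      rw [I2]
    have e3 : (-p)⁻¹ / (Complex.I * p ^ 2)⁻¹ ^ 2 = p ^ 4 / p := by
      field_simp
      rw [I2]
      ring
    rw [e1, e2, e3, thetaProduct_div_self hQ0, inv_inv, hdiv _ (div_ne_zero z0 hQ0), hdiv _ z0,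
      hdiv _ (inv_ne_zero hp0), hinv _ z0, hinv _ hp0, hinv _ (neg_ne_zero.mpr hp0),
      BurnsideCusp.branchValue]
    field_simp
    rw [Complex.I_pow_four, one_mul]
  | one =>
    have hd : (τ : ℂ) - 1 ≠ 0 := fun h => by
      simpa [τ.im_ne_zero] using congrArg Complex.im h
    have hτ : ((1 : ℤ) * (τ : ℂ) + (-1 : ℤ)) * (τ' : ℂ) = (1 : ℤ) * (τ : ℂ) + (-2 : ℤ) := by
      rw [h, BurnsideCusp.moebius]
      push_cast
      rw [← sub_eq_add_neg, ← sub_eq_add_neg, one_mul, mul_div_cancel₀ _ hd]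
    have e0 : (-Complex.I * p)⁻¹ = Complex.I * p⁻¹ := by
      rw [mul_inv, inv_neg, Complex.inv_I, neg_neg]
    rw [burnsideX_eq_thetaProduct (by norm_num) hτ hpe.symm (z := (-Complex.I * p)⁻¹)
      (w := (-p)⁻¹) (by simp [mul_comm]) (by simp [zpow_ofNat, inv_neg])]
    have z0 : -Complex.I * p ≠ 0 := by simp [hp0]
    have n0 := hne (-1) 1 (by norm_num) (-Complex.I * p) (by
      push_cast
      rw [expCoord_add, one_mul, expCoord_neg, expCoord_one, hpe, Complex.inv_I])
    have e1 : (-Complex.I * p)⁻¹ ^ 3 = -Complex.I * p / p ^ 4 := by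
      rw [e0, mul_pow, I3]
      field_simp
    have e2 : (-p)⁻¹ * (-Complex.I * p)⁻¹ ^ 2 = p / p ^ 4 := by
      rw [e0, mul_pow, I2]
      field_simp
    have e3 : (-p)⁻¹ / (-Complex.I * p)⁻¹ ^ 2 = p := by
      rw [e0, mul_pow, I2]
      field_simp
    rw [e1, e2, e3, inv_inv, hdiv _ z0, hdiv _ hp0, hinv _ z0, hinv _ (neg_ne_zero.mpr hp0),
      BurnsideCusp.branchValue]
    generalize thetaProduct (p ^ 4) (-Complex.I * p) = t at n0 ⊢
    field_simp
    rw [I2, neg_one_mul, neg_neg]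
  | negOne =>
    have hd : (τ : ℂ) + 1 ≠ 0 := fun h => by
      simpa [τ.im_ne_zero] using congrArg Complex.im h
    have hτ : ((1 : ℤ) * (τ : ℂ) + (1 : ℤ)) * (τ' : ℂ) = (3 : ℤ) * (τ : ℂ) + (2 : ℤ) := by
      rw [h, BurnsideCusp.moebius]
      push_cast
      rw [one_mul, mul_div_cancel₀ _ hd]
    have e0 : (Complex.I * p)⁻¹ = -Complex.I * p⁻¹ := by
      rw [mul_inv, Complex.inv_I]
    rw [burnsideX_eq_thetaProduct (by norm_num) hτ hpe.symm (z := (Complex.I * p)⁻¹)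
      (w := -p) (by simp [zpow_ofNat, I3, mul_comm]) (by simp [zpow_neg, zpow_ofNat])]
    have z0 : Complex.I * p ≠ 0 := by simp [hp0]
    have n0 := hne 1 1 (by norm_num) (Complex.I * p) (by
      push_cast
      rw [expCoord_add, one_mul, expCoord_one, hpe])
    have e1 : (Complex.I * p)⁻¹ ^ 3 = Complex.I * p / p ^ 4 := by
      field_simp
      rw [Complex.I_pow_four]
    have e2 : -p * (Complex.I * p)⁻¹ ^ 2 = p⁻¹ := by
      field_simp
      rw [I2]
    have e3 : -p / (Complex.I * p)⁻¹ ^ 2 = p ^ 4 / p := by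
      field_simp
      rw [I2]
      ring
    rw [e1, e2, e3, inv_inv, thetaProduct_div_self hQ0, hdiv _ z0, hinv _ hp0, hinv _ z0,
      BurnsideCusp.branchValue]
    field_simp
    rw [I2, neg_one_mul]

/-! ### Burnside's y as a theta quotient -/

/-- Merging even and odd terms passes from base t² to base t; pairing z with -z then returns to base
t² at z². -/
theorem thetaProduct_duplication {t z : ℂ} (ht : ‖t‖ < 1) (ht0 : t ≠ 0) :
    thetaProduct (t ^ 2) z * thetaProduct (t ^ 2) (-z) * thetaProduct (t ^ 2) (t * z) *
      thetaProduct (t ^ 2) (-(t * z)) = thetaProduct (t ^ 2) (z ^ 2) := by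
  have a1 := qPochhammer_even_mul_odd ht z
  have a2 := qPochhammer_even_mul_odd ht (-z)
  have a3 := qPochhammer_even_mul_odd ht (t / z)
  have a4 := qPochhammer_even_mul_odd ht (-(t / z))
  have b1 := qPochhammer_mul_neg ht z
  have b2 := qPochhammer_mul_neg ht (t / z)
  have e1 : t ^ 2 / (t * z) = t / z := by rw [sq, mul_div_mul_left _ _ ht0]
  have e2 : t * (t / z) = t ^ 2 / z := by ring
  rw [mul_neg] at a2
  rw [e2] at a3
  rw [mul_neg, e2] at a4
  rw [div_pow] at b2
  simp only [thetaProduct, div_neg, e1]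
  rw [← b1, ← b2, ← a1, ← a2, ← a3, ← a4]
  ring

theorem burnsideY_eq_thetaProduct (τ : UpperHalfPlane) {r : ℂ} (hr : r = expCoord (τ / 2)) :
    burnsideY τ = -4 * r * (thetaProduct (r ^ 8) (r ^ 2) /
      (thetaProduct (r ^ 8) (r ^ 4) * thetaProduct (r ^ 8) (-r ^ 2))) ^ 3 := by
  have hr0 : r ≠ 0 := hr ▸ expCoord_ne_zero _
  have cτ : expCoord τ = r ^ 2 := by
    rw [hr, ← expCoord_nat_mul]
    congr 1
    push_cast
    ring
  have hQr : nome τ = r ^ 8 := by rw [nome_eq_pow, cτ, ← pow_mul]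
  -- κ is the square root exp(πi/4) of i, the coordinate of the point 1/2.
  set κ := expCoord (1 / 2) with hκ
  have hκ0 : κ ≠ 0 := expCoord_ne_zero _
  have hκ2 : κ ^ 2 = Complex.I := by
    rw [hκ, ← expCoord_nat_mul, ← expCoord_one]
    congr 1
    push_cast
    ring
  have I0 := Complex.I_ne_zero
  have I2 := Complex.I_sq
  have c1 : expCoord (2 * τ) = r ^ 4 := by
    have := expCoord_nat_mul 2 τ
    push_cast at this
    rw [this, cτ]
    ring
  have c2 : expCoord (τ + 2) = -r ^ 2 := by
    rw [expCoord_add, cτ, expCoord_two, mul_neg_one]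
  have c3 : expCoord (2 * τ + 1) = Complex.I * r ^ 4 := by
    rw [expCoord_add, c1, expCoord_one, mul_comm]
  have m1 : (1 : ℂ) ∉ (burnsidePeriods τ).lattice := by
    simpa using notMem_burnsidePeriods_lattice τ 1 0 (by norm_num)
  have m2 : (τ : ℂ) ∉ (burnsidePeriods τ).lattice := by
    simpa using notMem_burnsidePeriods_lattice τ 0 1 (by norm_num)
  have m3 : 2 * (τ : ℂ) ∉ (burnsidePeriods τ).lattice := by
    simpa using notMem_burnsidePeriods_lattice τ 0 2 (by norm_num)
  have m4 : (τ : ℂ) / 2 ∉ (burnsidePeriods τ).lattice := by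
    simpa [div_eq_inv_mul] using notMem_burnsidePeriods_lattice τ 0 (1 / 2) (by norm_num)
  have m5 : (τ : ℂ) + 2 ∉ (burnsidePeriods τ).lattice := by
    simpa [add_comm] using notMem_burnsidePeriods_lattice τ 2 1 (by norm_num)
  have m6 : (1 / 2 : ℂ) ∉ (burnsidePeriods τ).lattice := by
    simpa using notMem_burnsidePeriods_lattice τ (1 / 2) 0 (by norm_num)
  have m7 : 2 * (τ : ℂ) + 1 ∉ (burnsidePeriods τ).lattice := by
    simpa [add_comm] using notMem_burnsidePeriods_lattice τ 1 2 (by norm_num)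
  have d1 := weierstrassP_sub τ m2 m3
  have d2 := weierstrassP_sub τ m4 m2
  have d3 := weierstrassP_sub τ m4 m5
  have d4 := weierstrassP_sub τ m6 m7
  have d5 := weierstrassP_sub τ m6 m1
  have d6 := weierstrassP_sub τ m4 m1
  have d7 := weierstrassP_sub τ m4 m7
  have d8 := derivWeierstrassP_eq τ m6
  have d9 := derivWeierstrassP_eq τ m2
  have n1 := thetaProduct_expCoord_ne_zero m1
  have n2 := thetaProduct_expCoord_ne_zero m2
  have n3 := thetaProduct_expCoord_ne_zero m3
  have n4 := thetaProduct_expCoord_ne_zero m4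
  have n5 := thetaProduct_expCoord_ne_zero m5
  have n6 := thetaProduct_expCoord_ne_zero m6
  have n7 := thetaProduct_expCoord_ne_zero m7
  have hQ := norm_nome_lt_one τ
  have hφ := qPochhammer_ne_zero_of_norm_lt hQ hQ
  simp only [hQr, cτ, c1, c2, c3, expCoord_one, ← hr, ← hκ] at d1 d2 d3 d4 d5 d6 d7 d8 d9
  simp only [hQr, cτ, c1, c2, c3, expCoord_one, ← hr, ← hκ] at n1 n2 n3 n4 n5 n6 n7 hQ hφ
  have hQ0 : r ^ 8 ≠ 0 := pow_ne_zero 8 hr0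
  have hinv : ∀ z, z ≠ 0 → thetaProduct (r ^ 8) z⁻¹ = -thetaProduct (r ^ 8) z / z :=
    fun z hz => thetaProduct_inv hQ hz
  have hrefl : ∀ z, thetaProduct (r ^ 8) (r ^ 8 / z) = thetaProduct (r ^ 8) z :=
    fun z => thetaProduct_div_self hQ0
  have hdup : ∀ z, thetaProduct (r ^ 8) z * thetaProduct (r ^ 8) (-z) *
      thetaProduct (r ^ 8) (r ^ 4 * z) * thetaProduct (r ^ 8) (-(r ^ 4 * z)) =
      thetaProduct (r ^ 8) (z ^ 2) := fun z => by
    have h4 : ‖r ^ 4‖ < 1 := by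
      have : ‖r ^ 4‖ ^ 2 < 1 := by rwa [← norm_pow, ← pow_mul]
      exact lt_of_pow_lt_pow_left₀ 2 zero_le_one (by simpa using this)
    have := thetaProduct_duplication (z := z) h4 (pow_ne_zero 4 hr0)
    rwa [← pow_mul] at this
  have hW := weierstrassConst_ne_zero τ
  have hKφ : weierstrassConst τ = (Real.pi / 2) ^ 2 * qPochhammer (r ^ 8) (r ^ 8) ^ 4 := by
    rw [weierstrassConst, hQr]
  set K := weierstrassConst τ
  set φ := qPochhammer (r ^ 8) (r ^ 8)
  set T := thetaProduct (r ^ 8)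
  have hκ4 : κ ^ 4 = -1 := by rw [← I2, ← hκ2, ← pow_mul]
  have x1 : T (r ^ 2 * r ^ 4) = T (r ^ 2) := by
    rw [← hrefl]
    congr 1
    field_simp
  have x1' : T (r ^ 2 / r ^ 4) = -T (r ^ 2) / r ^ 2 := by
    rw [← hinv _ (pow_ne_zero 2 hr0)]
    congr 1
    field_simp
  have x2 : T (r * r ^ 2) = T (r ^ 4 * r) := by
    rw [← hrefl]
    congr 1
    field_simp
  have x2' : T (r / r ^ 2) = -T r / r := by
    rw [← hinv _ hr0]
    congr 1
    field_simp
  have x3 : T (r * -r ^ 2) = T (-(r ^ 4 * r)) := by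
    rw [← hrefl]
    congr 1
    field_simp
  have x3' : T (r / -r ^ 2) = T (-r) / r := by
    have := hinv _ (neg_ne_zero.mpr hr0)
    rw [neg_div_neg_eq] at this
    rw [← this]
    congr 1
    field_simp
  have x4 : T (κ * (Complex.I * r ^ 4)) = T (-(r ^ 4 * κ)) := by
    rw [← hrefl, ← hκ2]
    congr 1
    field_simp
    rw [hκ4, neg_neg]
  have x4' : T (κ / (Complex.I * r ^ 4)) = -T (r ^ 4 * κ) / (r ^ 4 * κ) := by
    rw [← hinv _ (mul_ne_zero (pow_ne_zero 4 hr0) hκ0), ← hκ2]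
    congr 1
    field_simp
  have x5 : T (κ * Complex.I) = T (-κ) / κ := by
    have := hinv _ (neg_ne_zero.mpr hκ0)
    rw [neg_div_neg_eq] at this
    rw [← this, ← hκ2]
    congr 1
    field_simp
    rw [hκ4]
  have x5' : T (κ / Complex.I) = -T κ / κ := by
    rw [← hinv _ hκ0, ← hκ2]
    congr 1
    field_simp
  have x6 : T (r * Complex.I) = T (Complex.I * r) := by rw [mul_comm]
  have x6' : T (r / Complex.I) = T (-(Complex.I * r)) := by
    rw [Complex.div_I, mul_comm]
  have x7 : T (r * (Complex.I * r ^ 4)) = T (r ^ 4 * (Complex.I * r)) := by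
    congr 1
    ring
  have x7' : T (r / (Complex.I * r ^ 4)) =
      -T (-(r ^ 4 * (Complex.I * r))) / (Complex.I * r ^ 3) := by
    have e : r / (Complex.I * r ^ 4) = (Complex.I * r ^ 3)⁻¹ := by field_simp
    have e' : Complex.I * r ^ 3 = r ^ 8 / -(r ^ 4 * (Complex.I * r)) := by
      field_simp
      rw [I2]
    rw [e, hinv _ (mul_ne_zero I0 (pow_ne_zero 3 hr0)), ← hrefl (-(r ^ 4 * (Complex.I * r))), ← e']
  -- Duplication at r, κ and ir collapses the four theta values that occur in the products of
  -- differences taken in pairs.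
  have y1 := hdup r
  have y2 := hdup κ
  have y3 := hdup (Complex.I * r)
  have e3 : (Complex.I * r) ^ 2 = -r ^ 2 := by
    rw [mul_pow, I2]
    ring
  have e8 : (r ^ 2) ^ 2 = r ^ 4 := by ring
  rw [e3] at y3
  rw [hκ2] at y2 d8
  rw [e8] at d9
  rw [x1, x1'] at d1
  rw [x2, x2'] at d2
  rw [x3, x3'] at d3
  rw [x4, x4'] at d4
  rw [x5, x5'] at d5
  rw [x6, x6'] at d6
  rw [x7, x7'] at d7
  have hpi : (Real.pi : ℂ) ≠ 0 := by simp [Real.pi_ne_zero]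
  have N1 := d1.trans (show _ = -K * r ^ 2 / T (r ^ 4) ^ 2 by field_simp)
  have N23 := (congrArg₂ (· * ·) d2 d3).trans (show _ = K ^ 2 * r ^ 2 *
    (T r * T (-r) * T (r ^ 4 * r) * T (-(r ^ 4 * r))) /
      (T r ^ 4 * T (r ^ 2) ^ 2 * T (-r ^ 2) ^ 2) by field_simp)
  have N45 := (congrArg₂ (· * ·) d4 d5).trans (show _ = K ^ 2 * κ *
    (T κ * T (-κ) * T (r ^ 4 * κ) * T (-(r ^ 4 * κ))) /
      (T κ ^ 4 * T (Complex.I * r ^ 4) ^ 2 * T Complex.I ^ 2) by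
        rw [← hκ2]
        field_simp)
  have D12 := (congrArg₂ (· * ·) d6 d7).trans (show _ = -K ^ 2 * Complex.I * r *
    (T (Complex.I * r) * T (-(Complex.I * r)) * T (r ^ 4 * (Complex.I * r)) *
      T (-(r ^ 4 * (Complex.I * r)))) /
      (T r ^ 4 * T (Complex.I * r ^ 4) ^ 2 * T Complex.I ^ 2) by field_simp)
  -- The two factors -(πi/2)φ² multiply to -K, since K = (π/2)²φ⁴. Numerator and denominator of y
  -- then both carry K⁵.
  have D34 := (congrArg₂ (· * ·) d8 d9).trans (show _ = -K ^ 3 * κ * r ^ 2 * T Complex.I *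
    T (r ^ 4) / (T κ ^ 4 * T (r ^ 2) ^ 4) by
      rw [pow_succ K 2, hKφ]
      field_simp
      rw [I2])
  rw [y1] at N23
  rw [y2] at N45
  rw [y3] at D12
  have hY : burnsideY τ = 4 * Complex.I * (-K * r ^ 2 / T (r ^ 4) ^ 2 *
      (K ^ 2 * r ^ 2 * T (r ^ 2) / (T r ^ 4 * T (r ^ 2) ^ 2 * T (-r ^ 2) ^ 2)) *
      (K ^ 2 * κ * T Complex.I / (T κ ^ 4 * T (Complex.I * r ^ 4) ^ 2 * T Complex.I ^ 2))) /
      (-K ^ 2 * Complex.I * r * T (-r ^ 2) /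
        (T r ^ 4 * T (Complex.I * r ^ 4) ^ 2 * T Complex.I ^ 2) *
      (-K ^ 3 * κ * r ^ 2 * T Complex.I * T (r ^ 4) / (T κ ^ 4 * T (r ^ 2) ^ 4))) := by
    rw [← N1, ← N23, ← N45, ← D12, ← D34]
    simp only [burnsideY]
    ring
  rw [hY]
  field_simp

/-! ### The curve equation and the choice of sign of y -/

theorem BurnsideCusp.continuous_q (c : BurnsideCusp) : Continuous c.q := by
  have hc := UpperHalfPlane.continuous_coe
  have hd : ∀ (τ : UpperHalfPlane) (a b : ℝ), a ≠ 0 → (a * (τ : ℂ) + b) ≠ 0 := fun τ a b ha h => by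
    simpa [τ.im_ne_zero, ha] using congrArg Complex.im h
  have hm : Continuous fun τ : UpperHalfPlane => c.moebius τ := by
    cases c with
    | half =>
      exact Continuous.div₀ (by fun_prop) (by fun_prop) fun τ => by
        simpa [sub_eq_add_neg] using hd τ 2 (-1) two_ne_zero
    | infty => exact hc.sub continuous_const
    | one =>
      exact Continuous.div₀ (by fun_prop) (by fun_prop) fun τ => by
        simpa [sub_eq_add_neg] using hd τ 1 (-1) one_ne_zero
    | negOne =>
      exact Continuous.div₀ (by fun_prop) (by fun_prop) fun τ => by
        simpa using hd τ 1 1 one_ne_zero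
  exact Complex.continuous_exp.comp (continuous_const.mul hm)

/-- The closed form of `∏ (1 + q^{4k})³ (1 + q^{2k})⁶`. -/
theorem tprod_burnsideFactorY {q : ℂ} (hq : ‖q‖ < 1) :
    ∏' k, burnsideFactorY q k = 1 / (oddProduct (q ^ 2) ^ 6 * oddProduct (q ^ 4) ^ 3) :=
  (hasProd_burnsideFactorY hq).tprod_eq

theorem tprod_burnsideFactorX {q : ℂ} (hq : ‖q‖ < 1) :
    ∏' k, burnsideFactorX q k = oddProduct (q ^ 4) ^ 2 / oddProduct (q ^ 2) ^ 4 :=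
  (hasProd_burnsideFactorX hq).tprod_eq

theorem tprod_burnsideFactorY_ne_zero {q : ℂ} (hq : ‖q‖ < 1) : ∏' k, burnsideFactorY q k ≠ 0 := by
  have h2 := norm_sq_lt_one hq
  have h4 := oddProduct_ne_zero (norm_sq_lt_one h2)
  rw [← pow_mul] at h4
  rw [tprod_burnsideFactorY hq]
  exact one_div_ne_zero (mul_ne_zero (pow_ne_zero 6 (oddProduct_ne_zero h2)) (pow_ne_zero 3 h4))

theorem continuous_tprod_burnsideFactorY (c : BurnsideCusp) :
    Continuous fun τ => ∏' k, burnsideFactorY (c.q τ) k := by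
  have h2 := fun τ => norm_sq_lt_one (c.norm_q_lt_one τ)
  have h4 : ∀ τ, ‖c.q τ ^ 4‖ < 1 := fun τ => by
    simpa only [← pow_mul] using norm_sq_lt_one (h2 τ)
  have hc := c.continuous_q
  simp only [fun τ => tprod_burnsideFactorY (c.norm_q_lt_one τ)]
  have k2 : Continuous fun τ => oddProduct (c.q τ ^ 2) :=
    continuousOn_oddProduct.comp_continuous (by fun_prop) fun τ => by simpa using h2 τ
  have k4 : Continuous fun τ => oddProduct (c.q τ ^ 4) :=
    continuousOn_oddProduct.comp_continuous (by fun_prop) fun τ => by simpa using h4 τ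
  exact continuous_const.div₀ ((k2.pow 6).mul (k4.pow 3)) fun τ =>
    mul_ne_zero (pow_ne_zero 6 (oddProduct_ne_zero (h2 τ)))
      (pow_ne_zero 3 (oddProduct_ne_zero (h4 τ)))

theorem BurnsideCusp.branchValue_pow_four (c : BurnsideCusp) : c.branchValue ^ 4 = 1 := by
  cases c <;> simp [branchValue, Even.neg_pow (by decide : Even 4)]

/-- The products satisfy the equation `Y² = X⁵ - X` of Burnside's curve. -/
theorem tprod_burnside_curve (c : BurnsideCusp) {s : ℂ} (hs : s ^ 2 = c.branchValue) {q : ℂ}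
    (hq : ‖q‖ < 1) :
    (4 * s * q * ∏' k, burnsideFactorY q k) ^ 2 =
      (c.branchValue * ∏' k, burnsideFactorX q k) ^ 5 -
        c.branchValue * ∏' k, burnsideFactorX q k := by
  have h2 := norm_sq_lt_one hq
  have J := oddProduct_neg_pow_eight h2
  have hm := oddProduct_mul_neg h2
  have n2 := oddProduct_ne_zero h2
  have n4 := oddProduct_ne_zero (norm_sq_lt_one h2)
  have e5 : c.branchValue ^ 5 = c.branchValue := by
    rw [pow_succ, c.branchValue_pow_four, one_mul]
  have e4 : q ^ 4 = (q ^ 2) ^ 2 := by ring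
  rw [tprod_burnsideFactorX hq, tprod_burnsideFactorY hq, mul_pow c.branchValue, e5, mul_pow,
    mul_pow _ q, mul_pow, hs, e4]
  have hB : oddProduct (-q ^ 2) = oddProduct ((q ^ 2) ^ 2) / oddProduct (q ^ 2) := by
    rw [← hm]
    field_simp
  -- With A = φ(q²), B = φ(q⁴), φ(-q²) = B/A and e⁵ = e, the claim is a multiple of Jacobi's
  -- identity.
  rw [hB] at J
  generalize oddProduct (q ^ 2) = A at *
  generalize oddProduct ((q ^ 2) ^ 2) = B at *
  generalize c.branchValue = e at *
  field_simp at J ⊢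
  linear_combination (-e) * J

/-- Here exp(πiτ/4) = iq, so the prefactor -4r gives s = -i. The cubed quotient is (B/A)/(B²A) =
1/(A²B) with A = φ(q²) and B = φ(q⁴). -/
theorem burnsideY_eq_infty (τ : UpperHalfPlane) :
    burnsideY τ = 4 * (-Complex.I) * BurnsideCusp.infty.q τ *
      ∏' k, burnsideFactorY (BurnsideCusp.infty.q τ) k := by
  have hq := BurnsideCusp.infty.norm_q_lt_one τ
  rw [burnsideY_eq_thetaProduct τ rfl, tprod_burnsideFactorY hq]
  have hq0 : BurnsideCusp.infty.q τ ≠ 0 := Complex.exp_ne_zero _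
  have hr : expCoord (τ / 2) = Complex.I * BurnsideCusp.infty.q τ := by
    have e : BurnsideCusp.infty.q τ = expCoord (τ / 2 - 1) := by
      rw [BurnsideCusp.q, BurnsideCusp.moebius, expCoord]
      congr 1
      ring
    rw [e, expCoord_sub, expCoord_one]
    field_simp
  rw [hr]
  generalize BurnsideCusp.infty.q τ = q at hq hq0 ⊢
  have h2 := norm_sq_lt_one hq
  have I2 := Complex.I_sq
  have i4 : (Complex.I * q) ^ 4 = (q ^ 2) ^ 2 := by
    rw [mul_pow, Complex.I_pow_four]
    ring
  have i2 : (Complex.I * q) ^ 2 = -q ^ 2 := by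
    rw [mul_pow, I2]
    ring
  have i8 : (Complex.I * q) ^ 8 = (q ^ 2) ^ 4 := by
    rw [show (8 : ℕ) = 4 * 2 by norm_num, pow_mul, i4]
    ring
  have t1 := thetaProduct_pow_four_self h2 (pow_ne_zero 2 hq0)
  have t2 := thetaProduct_pow_four_self (p := -q ^ 2) (by simpa using h2) (by simpa using hq0)
  rw [Even.neg_pow (by decide)] at t2
  have t3 := thetaProduct_sq_self ((q ^ 2) ^ 2)
  rw [← pow_mul (q ^ 2) 2 2] at t3
  have e4 : q ^ 4 = (q ^ 2) ^ 2 := by ring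
  have hm := oddProduct_mul_neg h2
  have n2 := oddProduct_ne_zero h2
  have n4 := oddProduct_ne_zero (norm_sq_lt_one h2)
  have hB : oddProduct (-q ^ 2) = oddProduct ((q ^ 2) ^ 2) / oddProduct (q ^ 2) := by
    rw [← hm]
    field_simp
  rw [i8, i4, i2, neg_neg, t1, t2, t3, hB, e4]
  field_simp

/-- The square of y is known from i∞, and x has a product form at every cusp; only a sign depending
on τ remains to be fixed. -/
theorem exists_burnsideY_eq (c : BurnsideCusp) : ∃ s : ℂ, s ^ 2 = c.branchValue ∧
    ∀ τ : UpperHalfPlane, burnsideY τ = 4 * s * c.q τ * ∏' k, burnsideFactorY (c.q τ) k := by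
  obtain ⟨s, hs⟩ := IsAlgClosed.exists_pow_nat_eq c.branchValue two_pos
  have hs0 : s ≠ 0 := by
    rintro rfl
    have := c.branchValue_pow_four
    simp [← hs] at this
  have hX : ∀ (c : BurnsideCusp) τ,
      burnsideX τ = c.branchValue * ∏' k, burnsideFactorX (c.q τ) k := fun c τ => by
    rw [burnsideX_eq c τ, tprod_burnsideFactorX (c.norm_q_lt_one τ)]
  have hcurve : ∀ τ, burnsideY τ ^ 2 = burnsideX τ ^ 5 - burnsideX τ := fun τ => by
    rw [burnsideY_eq_infty, tprod_burnside_curve .infty (by simp [BurnsideCusp.branchValue])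
      (BurnsideCusp.infty.norm_q_lt_one τ), ← hX]
  have hcont : Continuous burnsideY := by
    rw [funext burnsideY_eq_infty]
    exact (continuous_const.mul BurnsideCusp.infty.continuous_q).mul
      (continuous_tprod_burnsideFactorY .infty)
  -- Two continuous functions with equal squares on a connected space, one of them without zeros,
  -- agree up to one global sign.
  have h := isPreconnected_univ.eq_or_eq_neg_of_sq_eq (f := burnsideY)
    (g := fun τ => 4 * s * c.q τ * ∏' k, burnsideFactorY (c.q τ) k) hcont.continuousOn
    ((continuous_const.mul c.continuous_q).mul
      (continuous_tprod_burnsideFactorY c)).continuousOn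
    (fun τ _ => by
      simp only [Pi.pow_apply]
      rw [hcurve, tprod_burnside_curve c hs (c.norm_q_lt_one τ), ← hX])
    (fun {τ} _ => mul_ne_zero (mul_ne_zero (mul_ne_zero (by norm_num : (4 : ℂ) ≠ 0) hs0) (Complex.exp_ne_zero _))
      (tprod_burnsideFactorY_ne_zero (c.norm_q_lt_one τ)))
  rcases h with h | h
  · exact ⟨s, hs, fun τ => h (Set.mem_univ τ)⟩
  · refine ⟨-s, by rw [neg_sq, hs], fun τ => (h (Set.mem_univ τ)).trans ?_⟩
    simp only [Pi.neg_apply]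
    ring

/-! ### Assembly of the proposition -/

theorem proposition6 :
    -- the canonical integer series `∑ aₙ q²ⁿ` and `∑ bₙ q²ⁿ`
    ∃ a b : ℕ → ℤ,
      (a 0 = 1 ∧ a 1 = 4 ∧ a 2 = 8 ∧ a 3 = 16 ∧ a 4 = 32 ∧ a 5 = 56 ∧ a 6 = 96) ∧
      (b 0 = 1 ∧ b 1 = 6 ∧ b 2 = 24 ∧ b 3 = 80 ∧ b 4 = 231 ∧ b 5 = 606) ∧
      -- they converge in the unit disc, to the (convergent) infinite products
      (∀ q : ℂ, ‖q‖ < 1 →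
        Multipliable (burnsideFactorX q) ∧ Multipliable (burnsideFactorY q) ∧
        HasSum (fun n => (a n : ℂ) * q ^ (2 * n)) (∏' k, burnsideFactorX q k) ∧
        HasSum (fun n => (b n : ℂ) * q ^ (2 * n)) (∏' k, burnsideFactorY q k)) ∧
      -- they are the developments of Burnside's functions at the four cusps,
      -- which therefore have the product representations
      (∀ c : BurnsideCusp, ∃ s : ℂ, s ^ 2 = c.branchValue ∧
        ∀ τ : UpperHalfPlane, ‖c.q τ‖ < 1 ∧
          HasSum (fun n => c.branchValue * ((a n : ℂ) * c.q τ ^ (2 * n))) (burnsideX τ) ∧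
          HasSum (fun n => 4 * s * c.q τ * ((b n : ℂ) * c.q τ ^ (2 * n))) (burnsideY τ) ∧
          burnsideX τ = c.branchValue * ∏' k, burnsideFactorX (c.q τ) k ∧
          burnsideY τ = 4 * s * c.q τ * ∏' k, burnsideFactorY (c.q τ) k) ∧
      -- `Y² = X⁵ - X` is an identity between the products
      (∀ c : BurnsideCusp, ∀ s : ℂ, s ^ 2 = c.branchValue → ∀ q : ℂ, ‖q‖ < 1 →
        (4 * s * q * ∏' k, burnsideFactorY q k) ^ 2 =
          (c.branchValue * ∏' k, burnsideFactorX q k) ^ 5 -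
            c.branchValue * ∏' k, burnsideFactorX q k) := by
  have hXs := coeffX_initial
  have hYs := coeffY_initial
  simp only [List.range, List.range.loop, List.map_cons, List.map_nil, List.cons.injEq] at hXs hYs
  have hX := fun (q : ℂ) (hq : ‖q‖ < 1) => hasSum_coeffX hq
  have hY := fun (q : ℂ) (hq : ‖q‖ < 1) => hasSum_coeffY hq
  refine ⟨fun n => coeffX n, fun n => coeffY n, ?_, ?_, ?_, ?_, ?_⟩
  · obtain ⟨h0, h1, h2, h3, h4, h5, h6, -⟩ := hXs
    simp [h0, h1, h2, h3, h4, h5, h6]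
  · obtain ⟨h0, h1, h2, h3, h4, h5, -⟩ := hYs
    simp [h0, h1, h2, h3, h4, h5]
  · intro q hq
    exact ⟨(hasProd_burnsideFactorX hq).multipliable, (hasProd_burnsideFactorY hq).multipliable,
      by simpa using hX q hq, by simpa using hY q hq⟩
  · intro c
    obtain ⟨s, hs, h⟩ := exists_burnsideY_eq c
    refine ⟨s, hs, fun τ => ?_⟩
    have hq := c.norm_q_lt_one τ
    have hx : burnsideX τ = c.branchValue * ∏' k, burnsideFactorX (c.q τ) k := by
      rw [burnsideX_eq c τ, tprod_burnsideFactorX hq]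
    refine ⟨hq, ?_, ?_, hx, h τ⟩
    · rw [hx]
      simpa using (hX _ hq).mul_left c.branchValue
    · rw [h τ]
      simpa using (hY _ hq).mul_left (4 * s * c.q τ)
  · exact fun c s hs q hq => tprod_burnside_curve c hs hq
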